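/- Let $s\ge 1$, let $\boldsymbol u=(u_1,\dots,u_s)$ be positive real numbers, and let $P\subset[0,1)^s$ be a digital net over $\mathbb F_2=\{0,1\}$. That is, for integers $n\ge m\ge 1$ and matrices $C_1,\dots,C_s\in\mathbb F_2^{n\times m}$, $P=\{\boldsymbol x_0,\dots,\boldsymbol x_{2^m-1}\}$, where for $h=\sum_{i=1}^m h_i2^{i-1}$ the $j$-th coordinate of $\boldsymbol x_h$ is $\sum_{i=1}^n y_i2^{-i}$ with $(y_1,\dots,y_n)^\top=C_j(h_1,\dots,h_m)^\top$ (computed in $\mathbb F_2$). Its dual net is $$P^\perp=\{\boldsymbol k\in\mathbb N_0^s : C_1^\top\vec k_1+\dots+C_s^\top\vec k_s=\boldsymbol 0\in\mathbb F_2^m\},\qquad \vec k_j=(\kappa_{1,j},\dots,\kappa_{n,j})^\top,\quad k_j=\sum_{i\ge1}\kappa_{i,j}2^{i-1},\ \kappa_{i,j}\in\{0,1\}.$$ Put $$\mu_{\boldsymbol u}(\boldsymbol k)=\sum_{j=1}^s\sum_{i\ge1}(i+1-\log_2u_j)\,\kappa_{i,j},\qquad W_{\boldsymbol u}(P)=\sum_{\boldsymbol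 k\in P^\perp\setminus\{\boldsymbol 0\}}2^{-\mu_{\boldsymbol u}(\boldsymbol k)}.$$ Let $\mathcal F_{s,\boldsymbol u}$ be the space of all $f\in C^\infty([0,1]^s)$ with $$\|f\|_{\mathcal F_{s,\boldsymbol u}}=\sup_{\alpha\in\mathbb N_0^s}\frac{\|f^{(\alpha_1,\dots,\alpha_s)}\|_{L^1([0,1]^s)}}{\prod_{j=1}^su_j^{\alpha_j}}<\infty ,$$ and let $$e^{\mathrm{wor}}(P,\mathcal F_{s,\boldsymbol u})=\sup_{f\in\mathcal F_{s,\boldsymbol u},\ \|f\|_{\mathcal F_{s,\boldsymbol u}}\le1}\Bigl|\frac1{|P|}\sum_{\boldsymbol x\in P}f(\boldsymbol x)-\int_{[0,1)^s}f(\boldsymbol x)\,d\boldsymbol x\Bigr| .$$ Finally let $$A_{s,\boldsymbol u}=\prod_{j=1}^s\frac{1-e^{-u_j}}{u_j},\qquad B_{s,\boldsymbol u}=\prod_{j=1}^s\inf_{w\ge1}\Bigl(\frac{1-e^{-2^{-w}u_j}}{2^{-w}u_j}\prod_{i=1}^w\frac{1-e^{-2^{-i}u_j}}{2^{-i}u_j}\Bigr).$$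 Then $B_{s,\boldsymbol u}>0$, both $W_{\boldsymbol u}(P)$ and $e^{\mathrm{wor}}(P,\mathcal F_{s,\boldsymbol u})$ are finite, and $$\frac{B_{s,\boldsymbol u}}{A_{s,\boldsymbol u}}\,W_{\boldsymbol u}(P)\ \le\ e^{\mathrm{wor}}(P,\mathcal F_{s,\boldsymbol u})\ \le\ 2^s\,W_{\boldsymbol u}(P).$$ -/

import Mathlib

open scoped ContDiff ENNReal

noncomputable section

namespace QMC

/-- The half-open unit cube `[0,1)^s`. -/
def hoCube (s : ℕ) : Set (Fin s → ℝ) := Set.univ.pi fun _ => Set.Ico (0 : ℝ) 1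

/-- The closed unit cube `[0,1]^s`. -/
def cube (s : ℕ) : Set (Fin s → ℝ) := Set.univ.pi fun _ => Set.Icc (0 : ℝ) 1

/-! ### Quasi-Monte Carlo integration -/

/-- `I(f)`, the integral of `f` over `[0,1)^s`. -/
def integral {s : ℕ} (f : (Fin s → ℝ) → ℝ) : ℝ := ∫ x in hoCube s, f x

/-- `I_P(f)`, the average of `f` over the finite point set `P`. -/
def quadrature {s : ℕ} (P : Finset (Fin s → ℝ)) (f : (Fin s → ℝ) → ℝ) : ℝ :=
  1 / (P.card : ℝ) * ∑ x ∈ P, f x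

/-- `Err(f; P) = I_P(f) - I(f)`. -/
def err {s : ℕ} (f : (Fin s → ℝ) → ℝ) (P : Finset (Fin s → ℝ)) : ℝ :=
  quadrature P f - integral f

/-! ### The weighted space of smooth functions -/

/-- The partial derivative in the `j`-th variable on `[0,1]^s`
(one-sided at the two end points of the `j`-th side). -/
def pderiv {s : ℕ} (j : Fin s) (f : (Fin s → ℝ) → ℝ) (x : Fin s → ℝ) : ℝ :=
  derivWithin (fun t => f (Function.update x j t)) (Set.Icc 0 1) (x j)

/-- The mixed partial derivative `f^(α_1, …, α_s)` on `[0,1]^s`. -/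
def mixedPartial {s : ℕ} (α : Fin s → ℕ) (f : (Fin s → ℝ) → ℝ) : (Fin s → ℝ) → ℝ :=
  (List.finRange s).foldr (fun j g => (pderiv j)^[α j] g) f

/-- The norm `sup_α ‖f^(α)‖_{L¹([0,1]^s)} / ∏_j u_j^{α_j}`, with values in `[0, ∞]`. -/
def smoothNorm {s : ℕ} (u : Fin s → ℝ) (f : (Fin s → ℝ) → ℝ) : ℝ≥0∞ :=
  ⨆ α : Fin s → ℕ,
    MeasureTheory.eLpNorm (mixedPartial α f) 1 (MeasureTheory.volume.restrict (cube s)) /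
      ENNReal.ofReal (∏ j, u j ^ α j)

/-- The space `F_{s,u}` of the functions that are `C^∞` on `[0,1]^s` and have finite norm.
Only the values on `[0,1]^s` matter. -/
def smoothSpace {s : ℕ} (u : Fin s → ℝ) : Set ((Fin s → ℝ) → ℝ) :=
  {f | ContDiffOn ℝ ∞ f (cube s) ∧ smoothNorm u f < ⊤}

/-- The set of the `|Err(f; P)|`, for `f` in the unit ball of `F_{s,u}`. -/
def unitBallErrors {s : ℕ} (P : Finset (Fin s → ℝ)) (u : Fin s → ℝ) : Set ℝ :=
  {e | ∃ f ∈ smoothSpace u, smoothNorm u f ≤ 1 ∧ e = |err f P|}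

/-- The worst-case error `e^wor(P, F_{s,u})`. -/
def worstCaseError {s : ℕ} (P : Finset (Fin s → ℝ)) (u : Fin s → ℝ) : ℝ :=
  sSup (unitBallErrors P u)

/-! ### Digital nets over the field with two elements

Indices of binary digits start at `0` in the code: the digit `κ_{i+1}` of
`k = ∑_{i ≥ 0} κ_{i+1} 2^i` is the bit `i` of `k`. -/

/-- The first `n` binary digits of `k`, lowest first, as elements of the two-element field. -/
def digitVec (n k : ℕ) : Fin n → ZMod 2 := fun i => if k.testBit i then 1 else 0

/-- The point `x_h` of the digital net with generating matrices `C_1, …, C_s`: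
`x_j(h) = ∑_i y_i 2^{-i}`, where `y = C_j h`. -/
def netPoint {s n m : ℕ} (C : Fin s → Matrix (Fin n) (Fin m) (ZMod 2)) (h : ℕ) :
    Fin s → ℝ :=
  fun j => ∑ i : Fin n, (((C j).mulVec (digitVec m h) i).val : ℝ) * ((2 : ℝ) ^ ((i : ℕ) + 1))⁻¹

open Classical in
/-- The digital net `{x_0, …, x_{2^m - 1}}`. -/
def digitalNet {s n m : ℕ} (C : Fin s → Matrix (Fin n) (Fin m) (ZMod 2)) :
    Finset (Fin s → ℝ) :=
  (Finset.range (2 ^ m)).image (netPoint C)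

/-- The dual net: all `k` with `C_1ᵀ k_1 + ⋯ + C_sᵀ k_s = 0`. -/
def dualNet {s n m : ℕ} (C : Fin s → Matrix (Fin n) (Fin m) (ZMod 2)) :
    Set (Fin s → ℕ) :=
  {k | ∑ j, (C j).transpose.mulVec (digitVec n (k j)) = 0}

/-- `μ_u(k) = ∑_j ∑_{i ≥ 1} (i + 1 - log₂ u_j) κ_{i,j}`; the bits of `k_j` beyond its binary
length vanish. -/
def mu {s : ℕ} (u : Fin s → ℝ) (k : Fin s → ℕ) : ℝ :=
  ∑ j, ∑ i ∈ Finset.range (k j).size,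
    (((i + 1 : ℕ) : ℝ) + 1 - Real.logb 2 (u j)) * (((k j).testBit i).toNat : ℝ)

/-- The summand `2^{-μ_u(k)}` of the generalized WAFOM, on the dual net without `0`. -/
def wafomTerm {s n m : ℕ} (u : Fin s → ℝ) (C : Fin s → Matrix (Fin n) (Fin m) (ZMod 2))
    (k : ↥(dualNet C \ {0})) : ℝ :=
  (2 : ℝ) ^ (-mu u k.1)

/-- The generalized WAFOM `W_u(P) = ∑_{k ∈ P^⊥ ∖ {0}} 2^{-μ_u(k)}`. -/
def wafom {s n m : ℕ} (u : Fin s → ℝ) (C : Fin s → Matrix (Fin n) (Fin m) (ZMod 2)) : ℝ :=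
  ∑' k, wafomTerm u C k

/-! ### The constants -/

/-- `A_{s,u} = ∏_j (1 - exp(-u_j)) / u_j`. -/
def constA {s : ℕ} (u : Fin s → ℝ) : ℝ := ∏ j, (1 - Real.exp (-u j)) / u j

/-- `B_{s,u} = ∏_j inf_{w ≥ 1} ((1 - exp(-2^{-w} u_j)) / (2^{-w} u_j) *
∏_{1 ≤ i ≤ w} (1 - exp(-2^{-i} u_j)) / (2^{-i} u_j))`. -/
def constB {s : ℕ} (u : Fin s → ℝ) : ℝ :=
  ∏ j, ⨅ w : {w : ℕ // 1 ≤ w},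
    (1 - Real.exp (-(((2 : ℝ) ^ w.1)⁻¹ * u j))) / (((2 : ℝ) ^ w.1)⁻¹ * u j) *
      ∏ i ∈ Finset.Icc 1 w.1,
        (1 - Real.exp (-(((2 : ℝ) ^ i)⁻¹ * u j))) / (((2 : ℝ) ^ i)⁻¹ * u j)

end QMC

end

noncomputable section

namespace QMC

open MeasureTheory Set

/-! ### Walsh functions on the unit interval -/

/-! Both bounds rest on the Walsh expansion of the error. On a digital net, Walsh functions are
characters of the group of digit vectors, so the net average of `wal_k` is 1 for `k` in the dual net
and 0 otherwise. Hence the error of a continuous `f` is the limit of the sums of its Walsh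
coefficients over `k ≠ 0` in the dual net with all `k_j < 2^N` (`tendsto_sum_walshCoeff`). The limit
exists because the Walsh–Dirichlet kernel of order `2^N` is an approximate identity: it is
nonnegative, has mass 1 and vanishes at distance more than `2^{-N}`.

Upper bound: one integration by parts for each nonzero bit of `k` turns a coefficient, up to sign,
into the integral of a mixed derivative of `f` against a product of nonnegative kernels
(`exists_walsh_kernel`). In each variable the kernel is at most twice its mean, and the mean is the
product of the `2^{-(i+2)}` over the nonzero bits `i ≥ 0`. If `f` has norm at most 1, the derivative
supplies the powers of `u_j`, so the coefficient is at most `2^s * 2^{-μ_u(k)}`.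

Lower bound: for the normalized product of the `exp(-u_j x_j)`, which lies in the unit ball, every
Walsh coefficient is at least `B/A * 2^{-μ_u(k)}` (`walshCoeff_expProd_ge`). All of them are
positive, so nothing cancels in the error. -/

/-- The doubling map `x ↦ 2x mod 1` on `[0,1)`. -/
def doubling (x : ℝ) : ℝ := if x < 1 / 2 then 2 * x else 2 * x - 1

/-- The first Rademacher function. -/
def rademacher (x : ℝ) : ℝ := if x < 1 / 2 then 1 else -1

/-- The Walsh function `wal_k` for `k < 2^N`. For larger `k`, only the first `N` bits count. -/
def wal : ℕ → ℕ → ℝ → ℝ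
  | 0, _, _ => 1
  | N + 1, k, x => (if k.testBit 0 then rademacher x else 1) * wal N (k / 2) (doubling x)

/-- The number of nonzero bits among the first `N` bits of `k`. -/
def bitCount : ℕ → ℕ → ℕ
  | 0, _ => 0
  | N + 1, k => (if k.testBit 0 then 1 else 0) + bitCount N (k / 2)

/-- The product of the `u / 2^(i+2)` over the nonzero bits `i < N` of `k`. -/
def bitWeight (u : ℝ) : ℕ → ℕ → ℝ := fun N k =>
  ∏ i ∈ Finset.range N, if k.testBit i then u / 2 ^ (i + 2) else 1

/-- Removing the lowest bit moves the others down one place, which amounts to halving `u`. This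
mirrors the effect of rescaling half of the unit interval to the whole, and the inductions on `N`
use the two together. -/
theorem bitWeight_succ (u : ℝ) (N k : ℕ) :
    bitWeight u (N + 1) k = (if k.testBit 0 then u / 4 else 1) * bitWeight (u / 2) N (k / 2) := by
  unfold bitWeight
  rw [Finset.prod_range_succ', mul_comm]
  congr 1
  · norm_num
  · refine Finset.prod_congr rfl fun i _ => ?_
    rw [Nat.testBit_succ]
    congr 1
    field_simp
    ring

theorem bitWeight_nonneg {u : ℝ} (hu : 0 ≤ u) (N k : ℕ) : 0 ≤ bitWeight u N k :=
  Finset.prod_nonneg fun i _ => by split_ifs <;> positivity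

theorem bitWeight_zero_right (u : ℝ) (N : ℕ) : bitWeight u N 0 = 1 := by
  simp [bitWeight]

theorem bitWeight_eq_pow_mul (u : ℝ) (N k : ℕ) :
    bitWeight u N k = u ^ bitCount N k * bitWeight 1 N k := by
  induction N generalizing u k with
  | zero => simp [bitWeight, bitCount]
  | succ N ih =>
    rw [bitWeight_succ, bitWeight_succ 1, ih (u / 2), ih (1 / 2), bitCount]
    split_ifs <;> simp only [div_pow, one_pow] <;> ring

theorem bitWeight_eq_of_lt (u : ℝ) {M N k : ℕ} (hMN : M ≤ N) (hk : k < 2 ^ M) :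
    bitWeight u N k = bitWeight u M k := by
  refine (Finset.prod_subset (Finset.range_mono hMN) fun i _ hi => ?_).symm
  rw [Nat.testBit_lt_two_pow (hk.trans_le (Nat.pow_le_pow_right two_pos (by simpa using hi)))]
  simp

theorem sum_range_two_mul {M : Type*} [AddCommMonoid M] (g : ℕ → M) (n : ℕ) :
    ∑ k ∈ Finset.range (2 * n), g k = ∑ k ∈ Finset.range n, (g (2 * k) + g (2 * k + 1)) := by
  induction n with
  | zero => simp
  | succ n ih =>
    rw [mul_add, mul_one, Finset.sum_range_succ, Finset.sum_range_succ, Finset.sum_range_succ, ih,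
      add_assoc]

/-- The sum factors as the product of the `1 + u / 2^(i+2)`; then `1 + t ≤ exp t`, and the exponents
sum to at most `u / 2`. -/
theorem sum_bitWeight_le {u : ℝ} (hu : 0 ≤ u) (N : ℕ) :
    ∑ k ∈ Finset.range (2 ^ N), bitWeight u N k ≤ Real.exp (u / 2) := by
  induction N generalizing u with
  | zero => simpa [bitWeight] using by positivity
  | succ N ih =>
    rw [pow_succ', sum_range_two_mul]
    have h : ∀ k, bitWeight u (N + 1) (2 * k) + bitWeight u (N + 1) (2 * k + 1)
        = (1 + u / 4) * bitWeight (u / 2) N k := by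
      intro k
      rw [bitWeight_succ, bitWeight_succ]
      have h1 : 2 * k / 2 = k := by omega
      have h2 : (2 * k + 1) / 2 = k := by omega
      simp [h1, h2]
      ring
    simp only [h, ← Finset.mul_sum]
    calc (1 + u / 4) * ∑ k ∈ Finset.range (2 ^ N), bitWeight (u / 2) N k
        ≤ Real.exp (u / 4) * Real.exp (u / 2 / 2) := by
          have := Real.add_one_le_exp (u / 4)
          exact mul_le_mul (by linarith) (ih (by positivity))
            (Finset.sum_nonneg fun k _ => bitWeight_nonneg (by positivity) _ _) (by positivity)
      _ = Real.exp (u / 2) := by rw [← Real.exp_add]; ring_nf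

theorem abs_rademacher (x : ℝ) : |rademacher x| = 1 := by
  unfold rademacher; split_ifs <;> simp

theorem abs_wal (N k : ℕ) (x : ℝ) : |wal N k x| = 1 := by
  induction N generalizing k x with
  | zero => simp [wal]
  | succ N ih => rw [wal, abs_mul, ih]; split_ifs <;> simp [abs_rademacher]

theorem wal_zero_right (N : ℕ) (x : ℝ) : wal N 0 x = 1 := by
  induction N generalizing x with
  | zero => simp [wal]
  | succ N ih => simp [wal, ih]

theorem measurable_doubling : Measurable doubling :=
  Measurable.ite measurableSet_Iio (by fun_prop) (by fun_prop)

theorem measurable_rademacher : Measurable rademacher :=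
  Measurable.ite measurableSet_Iio (by fun_prop) (by fun_prop)

theorem measurable_wal (N k : ℕ) : Measurable (wal N k) := by
  induction N generalizing k with
  | zero => exact measurable_const
  | succ N ih =>
    refine Measurable.mul ?_ ((ih (k / 2)).comp measurable_doubling)
    split_ifs
    · exact measurable_rademacher
    · exact measurable_const

theorem wal_succ_left (N k : ℕ) {y : ℝ} (hy : y < 1) :
    wal (N + 1) k (y / 2) = wal N (k / 2) y := by
  have h : y / 2 < 1 / 2 := by linarith
  have h2 : doubling (y / 2) = y := by rw [doubling, if_pos h]; ring
  rw [wal, h2, rademacher, if_pos h, ite_self, one_mul]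

theorem wal_succ_right (N k : ℕ) {y : ℝ} (hy : 0 ≤ y) :
    wal (N + 1) k (y / 2 + 1 / 2) = (if k.testBit 0 then -1 else 1) * wal N (k / 2) y := by
  have h : ¬ y / 2 + 1 / 2 < 1 / 2 := by linarith
  have h2 : doubling (y / 2 + 1 / 2) = y := by rw [doubling, if_neg h]; ring
  have h3 : rademacher (y / 2 + 1 / 2) = -1 := by rw [rademacher, if_neg h]
  rw [wal, h2, h3]

/-- Splitting an integral over the unit interval at the midpoint. -/
theorem integral_halves {H a b : ℝ → ℝ} (hH : IntervalIntegrable H volume 0 1)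
    (ha : ∀ y ∈ Ioo (0 : ℝ) 1, H (y / 2) = a y)
    (hb : ∀ y ∈ Ioo (0 : ℝ) 1, H (y / 2 + 1 / 2) = b y) :
    ∫ x in (0 : ℝ)..1, H x
      = 1 / 2 * ((∫ y in (0 : ℝ)..1, a y) + ∫ y in (0 : ℝ)..1, b y) := by
  have h1 : IntervalIntegrable H volume 0 (1 / 2) :=
    hH.mono_set (by rw [uIcc_of_le (by norm_num), uIcc_of_le (by norm_num)]
                    exact Icc_subset_Icc le_rfl (by norm_num))
  have h2 : IntervalIntegrable H volume (1 / 2) 1 :=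
    hH.mono_set (by rw [uIcc_of_le (by norm_num), uIcc_of_le (by norm_num)]
                    exact Icc_subset_Icc (by norm_num) le_rfl)
  rw [← intervalIntegral.integral_congr_Ioo_of_le zero_le_one ha,
    ← intervalIntegral.integral_congr_Ioo_of_le zero_le_one hb,
    intervalIntegral.integral_comp_div _ two_ne_zero,
    intervalIntegral.integral_comp_div_add _ two_ne_zero,
    ← intervalIntegral.integral_add_adjacent_intervals h1 h2]
  norm_num
  ring

theorem intervalIntegrable_mul_wal {F : ℝ → ℝ} (hF : IntervalIntegrable F volume 0 1) (N k : ℕ) :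
    IntervalIntegrable (fun x => F x * wal N k x) volume 0 1 := by
  rw [intervalIntegrable_iff] at hF ⊢
  exact hF.mul_bdd (c := 1) (measurable_wal N k).aestronglyMeasurable
    (Filter.Eventually.of_forall fun x => by simp [abs_wal])

theorem integral_mul_wal_succ {F : ℝ → ℝ} (hF : IntervalIntegrable F volume 0 1) (N k : ℕ) :
    ∫ x in (0 : ℝ)..1, F x * wal (N + 1) k x
      = 1 / 2 * ((∫ y in (0 : ℝ)..1, F (y / 2) * wal N (k / 2) y)
        + (if k.testBit 0 then -1 else 1)
          * ∫ y in (0 : ℝ)..1, F (y / 2 + 1 / 2) * wal N (k / 2) y) := by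
  rw [← intervalIntegral.integral_const_mul]
  refine integral_halves (intervalIntegrable_mul_wal hF _ _) (fun y hy => ?_) fun y hy => ?_
  · rw [wal_succ_left N k hy.2]
  · rw [wal_succ_right N k hy.1.le]; ring

theorem integral_wal {N k : ℕ} (hk : k < 2 ^ N) :
    ∫ x in (0 : ℝ)..1, wal N k x = if k = 0 then 1 else 0 := by
  induction N generalizing k with
  | zero => simp at hk; simp [hk, wal]
  | succ N ih =>
    have h := integral_mul_wal_succ (F := fun _ => 1) (by simp) N k
    simp only [one_mul] at h
    rw [h, ih (by omega)]
    by_cases hb : k.testBit 0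
    · have : k ≠ 0 := by rintro rfl; simp at hb
      simp only [hb, this, if_true, if_false]; ring
    · have : k / 2 = 0 ↔ k = 0 := by
        rw [Nat.testBit_zero] at hb; simp at hb; omega
      by_cases h0 : k = 0 <;> simp [hb, this, h0]; norm_num

/-! ### The Walsh–Dirichlet kernel -/

/-- The kernel `∑_{k < 2^N} wal_k(x) wal_k(y)`. -/
def walKernel (N : ℕ) (x y : ℝ) : ℝ := ∑ k ∈ Finset.range (2 ^ N), wal N k x * wal N k y

theorem walKernel_succ (N : ℕ) (x y : ℝ) :
    walKernel (N + 1) x y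
      = (1 + rademacher x * rademacher y) * walKernel N (doubling x) (doubling y) := by
  unfold walKernel
  rw [pow_succ', sum_range_two_mul, Finset.mul_sum]
  refine Finset.sum_congr rfl fun k _ => ?_
  have h1 : 2 * k / 2 = k := by omega
  have h2 : (2 * k + 1) / 2 = k := by omega
  simp [wal, h1, h2]
  ring

theorem walKernel_nonneg (N : ℕ) (x y : ℝ) : 0 ≤ walKernel N x y := by
  induction N generalizing x y with
  | zero => simp [walKernel, wal]
  | succ N ih =>
    rw [walKernel_succ]
    refine mul_nonneg ?_ (ih _ _)
    unfold rademacher; split_ifs <;> norm_num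

theorem doubling_mem {x : ℝ} (hx : x ∈ Icc (0 : ℝ) 1) : doubling x ∈ Icc (0 : ℝ) 1 := by
  obtain ⟨h0, h1⟩ := hx
  unfold doubling; split_ifs <;> constructor <;> linarith

/-- If the first digits differ, the first factor is zero. Otherwise doubling doubles the distance,
and after `N` such steps it would exceed 1. -/
theorem walKernel_eq_zero {N : ℕ} {x y : ℝ} (hx : x ∈ Icc (0 : ℝ) 1) (hy : y ∈ Icc (0 : ℝ) 1)
    (h : (2⁻¹ : ℝ) ^ N < |x - y|) : walKernel N x y = 0 := by
  induction N generalizing x y with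
  | zero =>
    have : |x - y| ≤ 1 := abs_sub_le_iff.2 ⟨by linarith [hx.2, hy.1], by linarith [hy.2, hx.1]⟩
    simp at h; linarith
  | succ N ih =>
    rw [walKernel_succ]
    have key : rademacher x * rademacher y = -1 ∨
        doubling x - doubling y = 2 * (x - y) := by
      unfold rademacher doubling
      split_ifs <;> first | (left; norm_num; done) | (right; ring)
    rcases key with h1 | h1
    · simp [h1]
    · rw [ih (doubling_mem hx) (doubling_mem hy), mul_zero]
      rw [h1, abs_mul, abs_two]
      rw [pow_succ] at h
      linarith

theorem integral_walKernel (N : ℕ) (x : ℝ) : ∫ y in (0 : ℝ)..1, walKernel N x y = 1 := by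
  unfold walKernel
  rw [intervalIntegral.integral_finsetSum fun k _ => by
    simpa using intervalIntegrable_mul_wal (F := fun _ => wal N k x) (by simp) N k]
  simp_rw [intervalIntegral.integral_const_mul]
  rw [Finset.sum_congr rfl fun k hk => by rw [integral_wal (Finset.mem_range.1 hk)]]
  simp [wal_zero_right]

/-! ### Integral representation of Walsh coefficients -/

/-- The function that runs through `A` on `[0,1/2]` and through `B` on `[1/2,1]`. -/
def glue (A B : ℝ → ℝ) (x : ℝ) : ℝ := if x ≤ 1 / 2 then A (2 * x) else B (2 * x - 1)

theorem continuous_glue {A B : ℝ → ℝ} (hA : Continuous A) (hB : Continuous B) (h : A 1 = B 0) :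
    Continuous (glue A B) := by
  refine Continuous.if_le (by fun_prop) (by fun_prop) continuous_id continuous_const ?_
  rintro x rfl
  norm_num [h]

theorem glue_mem {A B : ℝ → ℝ} {S : Set ℝ} (hA : ∀ x ∈ Icc (0 : ℝ) 1, A x ∈ S)
    (hB : ∀ x ∈ Icc (0 : ℝ) 1, B x ∈ S) {x : ℝ} (hx : x ∈ Icc (0 : ℝ) 1) : glue A B x ∈ S := by
  obtain ⟨h0, h1⟩ := hx
  unfold glue
  split_ifs
  · exact hA _ ⟨by linarith, by linarith⟩
  · exact hB _ ⟨by linarith, by linarith⟩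

theorem integral_mul_glue {F A B : ℝ → ℝ} (hF : ContinuousOn F (Icc 0 1)) (hA : Continuous A)
    (hB : Continuous B) (h : A 1 = B 0) :
    ∫ x in (0 : ℝ)..1, F x * glue A B x
      = 1 / 2 * ((∫ y in (0 : ℝ)..1, F (y / 2) * A y)
        + ∫ y in (0 : ℝ)..1, F (y / 2 + 1 / 2) * B y) := by
  refine integral_halves ?_ (fun y hy => ?_) fun y hy => ?_
  · exact ContinuousOn.intervalIntegrable_of_Icc zero_le_one
      (hF.mul (continuous_glue hA hB h).continuousOn)
  · rw [glue, if_pos (by linarith [hy.2])]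
    congr 2; ring
  · rw [glue, if_neg (by linarith [hy.1])]
    congr 2; ring

theorem half_mem {x : ℝ} (hx : x ∈ Icc (0 : ℝ) 1) : x / 2 ∈ Icc (0 : ℝ) 1 :=
  ⟨by linarith [hx.1], by linarith [hx.2]⟩

theorem half_add_half_mem {x : ℝ} (hx : x ∈ Icc (0 : ℝ) 1) : x / 2 + 1 / 2 ∈ Icc (0 : ℝ) 1 :=
  ⟨by linarith [hx.1], by linarith [hx.2]⟩

theorem hasDerivWithinAt_half {F : ℝ → ℝ} {F' x : ℝ}
    (h : HasDerivWithinAt F F' (Icc 0 1) (x / 2)) :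
    HasDerivWithinAt (fun y => F (y / 2)) (1 / 2 * F') (Icc 0 1) x := by
  have := h.comp x ((hasDerivWithinAt_id x (Icc 0 1)).div_const 2) fun y hy => half_mem hy
  rwa [mul_comm] at this

theorem hasDerivWithinAt_half_add_half {F : ℝ → ℝ} {F' x : ℝ}
    (h : HasDerivWithinAt F F' (Icc 0 1) (x / 2 + 1 / 2)) :
    HasDerivWithinAt (fun y => F (y / 2 + 1 / 2)) (1 / 2 * F') (Icc 0 1) x := by
  have := h.comp x (((hasDerivWithinAt_id x (Icc 0 1)).div_const 2).add_const (1 / 2))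
    fun y hy => half_add_half_mem hy
  rwa [mul_comm] at this

/-- A sequence of functions on `[0,1]`, each the derivative of the one before. -/
def IsDerivSeq (F : ℕ → ℝ → ℝ) : Prop :=
  ∀ i, ∀ x ∈ Icc (0 : ℝ) 1, HasDerivWithinAt (F i) (F (i + 1) x) (Icc 0 1) x

theorem IsDerivSeq.continuousOn {F : ℕ → ℝ → ℝ} (hF : IsDerivSeq F) (i : ℕ) :
    ContinuousOn (F i) (Icc 0 1) := fun x hx => (hF i x hx).continuousWithinAt

theorem IsDerivSeq.half {F : ℕ → ℝ → ℝ} (hF : IsDerivSeq F) :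
    IsDerivSeq fun i x => (1 / 2) ^ i * F i (x / 2) := fun i x hx => by
  have := (hasDerivWithinAt_half (hF i _ (half_mem hx))).const_mul ((1 / 2 : ℝ) ^ i)
  simpa only [pow_succ, mul_assoc] using this

theorem IsDerivSeq.half_add_half {F : ℕ → ℝ → ℝ} (hF : IsDerivSeq F) :
    IsDerivSeq fun i x => (1 / 2) ^ i * F i (x / 2 + 1 / 2) := fun i x hx => by
  have := (hasDerivWithinAt_half_add_half (hF i _ (half_add_half_mem hx))).const_mul
    ((1 / 2 : ℝ) ^ i)
  simpa only [pow_succ, mul_assoc] using this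

/-- One integration by parts against the antiderivative of `W`, after folding `[0,1]` in half. -/
theorem integral_fold_sub {p q W : ℝ → ℝ} (hW : Continuous W)
    (hp : ∀ x ∈ Icc (0 : ℝ) 1, HasDerivWithinAt p (q x) (Icc 0 1) x)
    (hq : ContinuousOn q (Icc 0 1)) :
    (∫ y in (0 : ℝ)..1, p (y / 2) * W y) - ∫ y in (0 : ℝ)..1, p (y / 2 + 1 / 2) * W y
      = - ∫ y in (0 : ℝ)..1, q y * glue (fun y => ∫ t in (0 : ℝ)..y, W t)
          (fun y => (∫ t in (0 : ℝ)..1, W t) - ∫ t in (0 : ℝ)..y, W t) y := by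
  set V : ℝ → ℝ := fun y => ∫ t in (0 : ℝ)..y, W t with hV
  have hVc : Continuous V :=
    intervalIntegral.continuous_primitive (fun a b => hW.intervalIntegrable a b) 0
  have hV0 : V 0 = 0 := by simp [hV]
  have hpc : ContinuousOn p (Icc 0 1) := fun x hx => (hp x hx).continuousWithinAt
  have hp2 : ContinuousOn (fun y : ℝ => p (y / 2 + 1 / 2)) (Icc 0 1) :=
    hpc.comp (by fun_prop) fun y hy => half_add_half_mem hy
  have hq1 : ContinuousOn (fun y : ℝ => q (y / 2)) (Icc 0 1) :=
    hq.comp (by fun_prop) fun y hy => half_mem hy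
  have hq2 : ContinuousOn (fun y : ℝ => q (y / 2 + 1 / 2)) (Icc 0 1) :=
    hq.comp (by fun_prop) fun y hy => half_add_half_mem hy
  have ii : ∀ {f : ℝ → ℝ}, ContinuousOn f (Icc 0 1) → IntervalIntegrable f volume 0 1 :=
    fun hf => ContinuousOn.intervalIntegrable_of_Icc zero_le_one hf
  have hd : ∀ x, HasDerivAt V (W x) x := fun x =>
    intervalIntegral.integral_hasDerivAt_right (hW.intervalIntegrable _ _)
      (hW.stronglyMeasurableAtFilter _ _) hW.continuousAt
  change _ = - ∫ y in (0 : ℝ)..1, q y * glue V (fun y => V 1 - V y) y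
  clear_value V
  have e1 : ∫ y in (0 : ℝ)..1, p (y / 2) * W y
      = p (1 / 2) * V 1 - p (0 / 2) * V 0 - ∫ y in (0 : ℝ)..1, 1 / 2 * q (y / 2) * V y := by
    refine intervalIntegral.integral_mul_deriv_eq_deriv_mul_of_hasDerivWithinAt
      (u := fun y => p (y / 2)) (fun x hx => ?_)
      (fun x hx => (hd x).hasDerivWithinAt) ((ii hq1).const_mul _) (hW.intervalIntegrable _ _)
    rw [uIcc_of_le zero_le_one] at hx ⊢
    exact hasDerivWithinAt_half (hp _ (half_mem hx))
  have e2 : ∫ y in (0 : ℝ)..1, p (y / 2 + 1 / 2) * W y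
      = p (1 / 2 + 1 / 2) * V 1 - p (0 / 2 + 1 / 2) * V 0
        - ∫ y in (0 : ℝ)..1, 1 / 2 * q (y / 2 + 1 / 2) * V y := by
    refine intervalIntegral.integral_mul_deriv_eq_deriv_mul_of_hasDerivWithinAt
      (u := fun y => p (y / 2 + 1 / 2)) (fun x hx => ?_)
      (fun x hx => (hd x).hasDerivWithinAt) ((ii hq2).const_mul _) (hW.intervalIntegrable _ _)
    rw [uIcc_of_le zero_le_one] at hx ⊢
    exact hasDerivWithinAt_half_add_half (hp _ (half_add_half_mem hx))
  -- The boundary terms leave `(p(1/2) - p(1)) * V 1`. Writing this as an integral of `q` over the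
  -- right half changes the kernel there from `-V` to `V 1 - V`.
  have e3 : ∫ y in (0 : ℝ)..1, 1 / 2 * q (y / 2 + 1 / 2)
      = p (1 / 2 + 1 / 2) - p (0 / 2 + 1 / 2) := by
    refine intervalIntegral.integral_eq_sub_of_hasDerivAt_of_le
      (f := fun y => p (y / 2 + 1 / 2)) zero_le_one hp2
      (fun x hx => ?_) ((ii hq2).const_mul _)
    have hx' := Ioo_subset_Icc_self hx
    exact (hasDerivWithinAt_half_add_half (hp _ (half_add_half_mem hx'))).hasDerivAt
      (Icc_mem_nhds hx.1 hx.2)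
  rw [e1, e2, integral_mul_glue hq hVc (by fun_prop) (by simp [hV0]), hV0]
  have e4 : ∫ y in (0 : ℝ)..1, q (y / 2 + 1 / 2) * (V 1 - V y)
      = (∫ y in (0 : ℝ)..1, q (y / 2 + 1 / 2)) * V 1
        - ∫ y in (0 : ℝ)..1, q (y / 2 + 1 / 2) * V y := by
    rw [← intervalIntegral.integral_mul_const, ← intervalIntegral.integral_sub]
    · simp_rw [mul_sub]
    · exact (ii hq2).mul_const _
    · exact ii (hq2.mul hVc.continuousOn)
  rw [intervalIntegral.integral_const_mul] at e3
  simp_rw [mul_assoc]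
  rw [intervalIntegral.integral_const_mul, intervalIntegral.integral_const_mul]
  rw [e4]
  rw [show (1 / 2 + 1 / 2 : ℝ) = 1 by norm_num, show (0 / 2 + 1 / 2 : ℝ) = 1 / 2 by norm_num] at *
  linear_combination V 1 * e3

/-- Induction on the lowest bit. A zero bit repeats the kernel of `k / 2` on both halves. A nonzero
bit replaces it by its antiderivative `V`, run up on the left half and down on the right: the
maximum is `V 1`, the old mean, and the new mean is half of that. The factor 2 between maximum and
mean therefore never accumulates. The condition `W 0 = W 1` keeps the repeated kernel continuous. -/
theorem exists_walsh_kernel (N k : ℕ) :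
    ∃ W : ℝ → ℝ, Continuous W ∧ W 0 = W 1 ∧
      (∀ x ∈ Icc (0 : ℝ) 1, W x ∈ Icc 0 (2 * bitWeight 1 N k)) ∧
      ∫ x in (0 : ℝ)..1, W x = bitWeight 1 N k ∧
      ∀ F, IsDerivSeq F → ∫ x in (0 : ℝ)..1, F 0 x * wal N k x
        = (-1) ^ bitCount N k * ∫ x in (0 : ℝ)..1, F (bitCount N k) x * W x := by
  induction N generalizing k with
  | zero => exact ⟨fun _ => 1, continuous_const, rfl, by simp [bitWeight], by simp [bitWeight],
      fun F _ => by simp [bitCount, wal]⟩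
  | succ N ih =>
    obtain ⟨W, hc, h01, hb, hi, hF⟩ := ih (k / 2)
    set v := bitCount N (k / 2) with hv
    have hw : bitWeight (1 / 2) N (k / 2) = (1 / 2) ^ v * bitWeight 1 N (k / 2) :=
      bitWeight_eq_pow_mul _ _ _
    have hrec : ∀ F, IsDerivSeq F → ∫ x in (0 : ℝ)..1, F 0 x * wal (N + 1) k x
        = (-1) ^ v * (1 / 2) ^ v * (1 / 2) * ((∫ y in (0 : ℝ)..1, F v (y / 2) * W y)
          + (if k.testBit 0 then -1 else 1) * ∫ y in (0 : ℝ)..1, F v (y / 2 + 1 / 2) * W y) := by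
      intro F h
      have h1 := hF _ h.half
      have h2 := hF _ h.half_add_half
      simp only [pow_zero, one_mul, mul_assoc, intervalIntegral.integral_const_mul] at h1 h2
      rw [integral_mul_wal_succ
        (ContinuousOn.intervalIntegrable_of_Icc zero_le_one (h.continuousOn 0)), h1, h2]
      ring
    by_cases hk : k.testBit 0
    · set V : ℝ → ℝ := fun y => ∫ t in (0 : ℝ)..y, W t with hV
      have hVc : Continuous V :=
        intervalIntegral.continuous_primitive (fun a b => hc.intervalIntegrable a b) 0
      have hV0 : V 0 = 0 := by simp [hV]
      have hV1 : V 1 = bitWeight 1 N (k / 2) := hi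
      have hVm : ∀ x ∈ Icc (0 : ℝ) 1, V x ∈ Icc 0 (V 1) := by
        intro x hx
        refine ⟨intervalIntegral.integral_nonneg hx.1
          fun t ht => (hb t ⟨ht.1, ht.2.trans hx.2⟩).1, ?_⟩
        refine intervalIntegral.integral_mono_interval le_rfl hx.1 hx.2 ?_
          (hc.intervalIntegrable _ _)
        exact (ae_restrict_iff' measurableSet_Ioc).2
          (Filter.Eventually.of_forall fun t ht => (hb t (Ioc_subset_Icc_self ht)).1)
      have hfold : ∀ F, IsDerivSeq F → (∫ y in (0 : ℝ)..1, F v (y / 2) * W y)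
          - ∫ y in (0 : ℝ)..1, F v (y / 2 + 1 / 2) * W y
          = - ∫ y in (0 : ℝ)..1, F (v + 1) y * glue V (fun y => V 1 - V y) y :=
        fun F h => integral_fold_sub hc (h v) (h.continuousOn (v + 1))
      clear_value V
      have hgc : Continuous (glue V fun y => V 1 - V y) :=
        continuous_glue hVc (by fun_prop) (by simp [hV0])
      -- The chain rule gives `v` factors 1/2, and halving the interval gives one more. For a zero
      -- bit, the latter is absorbed when the two halves are glued.
      refine ⟨fun x => (1 / 2) ^ (v + 1) * glue V (fun y => V 1 - V y) x, by fun_prop,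
        by norm_num [glue, hV0], fun x hx => ?_, ?_, fun F h => ?_⟩
      · obtain ⟨g0, g1⟩ := glue_mem (S := Icc 0 (V 1)) (B := fun y => V 1 - V y) hVm
          (fun y hy => ⟨by linarith [(hVm y hy).2], by linarith [(hVm y hy).1]⟩) hx
        refine ⟨by positivity, ?_⟩
        rw [bitWeight_succ, if_pos hk, hw, ← hV1]
        calc (1 / 2) ^ (v + 1) * glue V (fun y => V 1 - V y) x
            ≤ (1 / 2) ^ (v + 1) * V 1 := by gcongr
          _ = _ := by ring
      · have h := integral_mul_glue (F := fun _ => 1) continuousOn_const hVc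
          (B := fun y => V 1 - V y) (by fun_prop) (by simp [hV0])
        simp only [one_mul] at h
        rw [intervalIntegral.integral_const_mul, h, bitWeight_succ, if_pos hk, hw, ← hV1,
          intervalIntegral.integral_sub (by simp) (hVc.intervalIntegrable _ _)]
        simp
        ring
      · rw [hrec F h, if_pos hk, neg_one_mul, ← sub_eq_add_neg,
          hfold F h, bitCount, if_pos hk, ← hv,
          add_comm 1 v]
        simp_rw [mul_left_comm _ ((1 / 2 : ℝ) ^ (v + 1))]
        rw [intervalIntegral.integral_const_mul]
        ring
    · have hgc : Continuous (glue W W) := continuous_glue hc hc h01.symm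
      have hv' : bitCount (N + 1) k = v := by rw [bitCount, if_neg hk, zero_add]
      refine ⟨fun x => (1 / 2) ^ v * glue W W x, by fun_prop,
        by norm_num [glue, h01], fun x hx => ?_, ?_, fun F h => ?_⟩
      · obtain ⟨g0, g1⟩ := glue_mem hb hb hx
        refine ⟨by positivity, ?_⟩
        rw [bitWeight_succ, if_neg hk, hw]
        calc (1 / 2) ^ v * glue W W x ≤ (1 / 2) ^ v * (2 * bitWeight 1 N (k / 2)) := by gcongr
          _ = _ := by ring
      · have h := integral_mul_glue (F := fun _ => 1) continuousOn_const hc hc h01.symm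
        simp only [one_mul] at h
        rw [intervalIntegral.integral_const_mul, h, bitWeight_succ, if_neg hk, hw, hi]
        ring
      · rw [hrec F h, if_neg hk, hv']
        simp_rw [mul_left_comm _ ((1 / 2 : ℝ) ^ v)]
        rw [intervalIntegral.integral_const_mul,
          integral_mul_glue (h.continuousOn v) hc hc h01.symm]
        ring

/-! ### Walsh coefficients of the exponential function -/

/-- `(1 - exp(-t)) / t`. -/
def expMean (t : ℝ) : ℝ := (1 - Real.exp (-t)) / t

/-- The factor of the constant `B` that belongs to `w`. -/
def betaFactor (u : ℝ) (w : ℕ) : ℝ :=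
  expMean (((2 : ℝ) ^ w)⁻¹ * u) * ∏ i ∈ Finset.Icc 1 w, expMean (((2 : ℝ) ^ i)⁻¹ * u)

theorem exp_neg_le_expMean {t : ℝ} (ht : 0 < t) : Real.exp (-t) ≤ expMean t := by
  rw [expMean, le_div_iff₀ ht]
  have h := Real.add_one_le_exp t
  have h2 : Real.exp (-t) * Real.exp t = 1 := by rw [← Real.exp_add]; simp
  nlinarith [Real.exp_pos (-t)]

theorem expMean_pos {t : ℝ} (ht : 0 < t) : 0 < expMean t :=
  (Real.exp_pos _).trans_le (exp_neg_le_expMean ht)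

/-- This is the trapezoidal rule for the convex function `exp(-x)` on `[0, t]`. Cleared of
denominators, the difference vanishes at 0 and has derivative `1 - (1 + x) exp(-x) ≥ 0`. -/
theorem expMean_le {t : ℝ} (ht : 0 < t) : expMean t ≤ (1 + Real.exp (-t)) / 2 := by
  have hd : ∀ x : ℝ, HasDerivAt (fun y : ℝ => y * (1 + Real.exp (-y)) - 2 * (1 - Real.exp (-y)))
      (1 - (1 + x) * Real.exp (-x)) x := by
    intro x
    have h1 : HasDerivAt (fun y : ℝ => Real.exp (-y)) (Real.exp (-x) * -1) x :=
      (hasDerivAt_neg x).exp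
    exact (((hasDerivAt_id' x).mul (h1.const_add 1)).sub
      ((h1.const_sub 1).const_mul 2)).congr_deriv (by ring)
  have hm : Monotone fun y : ℝ => y * (1 + Real.exp (-y)) - 2 * (1 - Real.exp (-y)) := by
    refine monotone_of_deriv_nonneg (fun x => (hd x).differentiableAt) fun x => ?_
    rw [(hd x).deriv, sub_nonneg]
    calc (1 + x) * Real.exp (-x) ≤ Real.exp x * Real.exp (-x) := by
          gcongr; linarith [Real.add_one_le_exp x]
      _ = 1 := by rw [← Real.exp_add]; simp
  have h := hm ht.le
  simp at h
  rw [expMean, div_le_div_iff₀ ht two_pos]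
  linarith

theorem betaFactor_succ (u : ℝ) (w : ℕ) :
    betaFactor u (w + 1) = expMean (u / 2) * betaFactor (u / 2) w := by
  unfold betaFactor
  have h : ∀ i : ℕ, ((2 : ℝ) ^ (i + 1))⁻¹ * u = ((2 : ℝ) ^ i)⁻¹ * (u / 2) := fun i => by
    rw [pow_succ, mul_inv]; ring
  have h2 : ∀ (f : ℕ → ℝ) n, ∏ i ∈ Finset.Icc 1 n, f i = ∏ i ∈ Finset.range n, f (i + 1) := by
    intro f n
    rw [Finset.range_eq_Ico, Finset.prod_Ico_add']; rfl
  rw [h2, h2, h, Finset.prod_range_succ']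
  simp only [h]
  norm_num
  ring

theorem betaFactor_zero (u : ℝ) : betaFactor u 0 = expMean u := by
  simp [betaFactor]

/-- Each factor satisfies `expMean t ≥ exp(-t)`, and the arguments `t` sum to `u`. The exponent `2 *
u` is not sharp; what matters is that the bound does not depend on `w`, so that the infimum in
`constB` is positive. -/
theorem exp_neg_le_betaFactor {u : ℝ} (hu : 0 < u) (w : ℕ) :
    Real.exp (-(2 * u)) ≤ betaFactor u w := by
  induction w generalizing u with
  | zero =>
    rw [betaFactor_zero]
    exact (Real.exp_le_exp.2 (by linarith)).trans (exp_neg_le_expMean hu)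
  | succ w ih =>
    rw [betaFactor_succ]
    calc Real.exp (-(2 * u)) ≤ Real.exp (-(u / 2)) * Real.exp (-(2 * (u / 2))) := by
          rw [← Real.exp_add]; exact Real.exp_le_exp.2 (by linarith)
      _ ≤ _ := mul_le_mul (exp_neg_le_expMean (by positivity)) (ih (by positivity))
          (by positivity) (expMean_pos (by positivity)).le

theorem betaFactor_pos {u : ℝ} (hu : 0 < u) (w : ℕ) : 0 < betaFactor u w :=
  (Real.exp_pos _).trans_le (exp_neg_le_betaFactor hu w)

theorem integral_exp_neg_mul {u : ℝ} (hu : 0 < u) :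
    ∫ x in (0 : ℝ)..1, Real.exp (-(u * x)) = expMean u := by
  have h : ∀ x ∈ uIcc (0 : ℝ) 1,
      HasDerivAt (fun x => -Real.exp (-(u * x)) / u) (Real.exp (-(u * x))) x := by
    intro x _
    have h1 : HasDerivAt (fun x => Real.exp (-(u * x))) (Real.exp (-(u * x)) * -(u * 1)) x :=
      (((hasDerivAt_id x).const_mul u).neg).exp
    exact (h1.neg.div_const u).congr_deriv (by field_simp)
  rw [intervalIntegral.integral_eq_sub_of_hasDerivAt h
    (Continuous.intervalIntegrable (by fun_prop) _ _), expMean]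
  simp
  ring

/-- Since `exp(-u x)` on the right half is `exp(-u/2)` times its copy on the left, each bit splits
off a factor `(1 ∓ exp(-u/2)) / 2`. With the minus sign (nonzero bit) it equals `u/4 * expMean
(u/2)`; with the plus sign it is at least `expMean (u/2)`. After `w` steps only the mean of
`exp(-2^{-w} u x)` remains. -/
theorem bitWeight_mul_betaFactor_le_integral {u : ℝ} (hu : 0 < u) {w N k : ℕ} (hw : k < 2 ^ w)
    (hwN : w ≤ N) : bitWeight u N k * betaFactor u w
      ≤ ∫ x in (0 : ℝ)..1, Real.exp (-(u * x)) * wal N k x := by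
  induction w generalizing u N k with
  | zero =>
    obtain rfl : k = 0 := by simpa using hw
    simp [wal_zero_right, bitWeight_zero_right, betaFactor_zero, integral_exp_neg_mul hu]
  | succ w ih =>
    obtain ⟨N, rfl⟩ : ∃ M, N = M + 1 := ⟨N - 1, by omega⟩
    have hu2 : 0 < u / 2 := by positivity
    have ih' := ih hu2 (N := N) (k := k / 2) (by omega) (by omega)
    rw [integral_mul_wal_succ (Continuous.intervalIntegrable (by fun_prop) _ _)]
    have h1 : ∀ y : ℝ, Real.exp (-(u * (y / 2))) = Real.exp (-(u / 2 * y)) := fun y => by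
      congr 1; ring
    have h2 : ∀ y : ℝ, Real.exp (-(u * (y / 2 + 1 / 2)))
        = Real.exp (-(u / 2)) * Real.exp (-(u / 2 * y)) := fun y => by
      rw [← Real.exp_add]; congr 1; ring
    simp_rw [h1, h2, mul_assoc]
    rw [intervalIntegral.integral_const_mul, bitWeight_succ, betaFactor_succ]
    set I := ∫ y in (0 : ℝ)..1, Real.exp (-(u / 2 * y)) * wal N (k / 2) y
    set b := bitWeight (u / 2) N (k / 2) * betaFactor (u / 2) w
    have hb : 0 ≤ b := mul_nonneg (bitWeight_nonneg hu2.le _ _) (betaFactor_pos hu2 w).le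
    split_ifs
    · have h3 : u / 4 * expMean (u / 2) = (1 - Real.exp (-(u / 2))) / 2 := by
        rw [expMean]; field_simp; ring
      have h4 : 0 ≤ (1 - Real.exp (-(u / 2))) / 2 := by
        rw [← h3]; exact mul_nonneg (by positivity) (expMean_pos hu2).le
      calc u / 4 * bitWeight (u / 2) N (k / 2) * (expMean (u / 2) * betaFactor (u / 2) w)
          = u / 4 * expMean (u / 2) * b := by ring
        _ ≤ (1 - Real.exp (-(u / 2))) / 2 * I := by rw [h3]; gcongr
        _ = _ := by ring
    · calc 1 * bitWeight (u / 2) N (k / 2) * (expMean (u / 2) * betaFactor (u / 2) w)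
          = expMean (u / 2) * b := by ring
        _ ≤ (1 + Real.exp (-(u / 2))) / 2 * I := by
          gcongr
          exact expMean_le hu2
        _ = _ := by ring

/-! ### Walsh functions on digital nets -/

theorem zmod_two_cases (a : ZMod 2) : a = 0 ∨ a = 1 := by
  revert a; decide

/-- The nontrivial additive character of the field with two elements. -/
def chi : AddChar (ZMod 2) ℝ where
  toFun a := if a = 0 then 1 else -1
  map_zero_eq_one' := by simp
  map_add_eq_mul' a b := by
    have h : (1 : ZMod 2) + 1 = 0 := by decide
    rcases zmod_two_cases a with rfl | rfl <;> rcases zmod_two_cases b with rfl | rfl <;> simp [h]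

theorem chi_apply (a : ZMod 2) : chi a = if a = 0 then 1 else -1 := rfl

theorem chi_injective : Function.Injective chi := by
  intro a b h
  simp only [chi_apply] at h
  rcases zmod_two_cases a with rfl | rfl <;> rcases zmod_two_cases b with rfl | rfl <;>
    first | rfl | norm_num at h

theorem chi_sum {ι : Type*} (S : Finset ι) (f : ι → ZMod 2) :
    chi (∑ i ∈ S, f i) = ∏ i ∈ S, chi (f i) := by
  classical
  induction S using Finset.induction_on with
  | empty => simp
  | insert a S ha ih => rw [Finset.sum_insert ha, Finset.prod_insert ha, AddChar.map_add_eq_mul, ih]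

/-- The number with the binary digits `y`, after the point. -/
def binPoint {n : ℕ} (y : Fin n → ZMod 2) : ℝ :=
  ∑ i : Fin n, ((y i).val : ℝ) * ((2 : ℝ) ^ ((i : ℕ) + 1))⁻¹

theorem binPoint_succ {n : ℕ} (y : Fin (n + 1) → ZMod 2) :
    binPoint y = binPoint (Fin.tail y) / 2 + ((y 0).val : ℝ) / 2 := by
  rw [binPoint, Fin.sum_univ_succ, add_comm, binPoint, Finset.sum_div]
  congr 1
  · refine Finset.sum_congr rfl fun i _ => ?_
    rw [Fin.val_succ, pow_succ, Fin.tail]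
    field_simp
  · simp [div_eq_mul_inv]

theorem binPoint_mem {n : ℕ} (y : Fin n → ZMod 2) : binPoint y ∈ Ico (0 : ℝ) 1 := by
  induction n with
  | zero => simp [binPoint]
  | succ n ih =>
    obtain ⟨h0, h1⟩ := ih (Fin.tail y)
    rw [binPoint_succ]
    rcases zmod_two_cases (y 0) with h | h <;> simp [h, ZMod.val_one] <;> constructor <;> linarith

theorem wal_zero_point (N k : ℕ) : wal N k 0 = 1 := by
  induction N generalizing k with
  | zero => rfl
  | succ N ih => simpa [ih] using wal_succ_left N k (y := 0) one_pos

theorem digitVec_dotProduct_succ {n : ℕ} (k : ℕ) (y : Fin (n + 1) → ZMod 2) :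
    digitVec (n + 1) k ⬝ᵥ y
      = (if k.testBit 0 then y 0 else 0) + digitVec n (k / 2) ⬝ᵥ Fin.tail y := by
  simp [dotProduct, Fin.sum_univ_succ, digitVec, Nat.testBit_succ, Fin.tail]

/-- The bits of `k` from `n` on meet zero digits of the point, so they may be dropped from the digit
vector. -/
theorem wal_binPoint {n N : ℕ} (hN : n ≤ N) (k : ℕ) (y : Fin n → ZMod 2) :
    wal N k (binPoint y) = chi (digitVec n k ⬝ᵥ y) := by
  induction n generalizing N k with
  | zero => simp [binPoint, wal_zero_point]
  | succ n ih =>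
    obtain ⟨N, rfl⟩ : ∃ M, N = M + 1 := ⟨N - 1, by omega⟩
    obtain ⟨h0, h1⟩ := binPoint_mem (Fin.tail y)
    rw [binPoint_succ, digitVec_dotProduct_succ, AddChar.map_add_eq_mul, ← ih (N := N) (by omega)]
    rcases zmod_two_cases (y 0) with h | h
    · simp [h, wal_succ_left N k h1]
    · simp only [h, ZMod.val_one, Nat.cast_one, wal_succ_right N k h0]
      congr 1
      split_ifs <;> simp [chi_apply]

theorem digitVec_two_pow {n : ℕ} (i : Fin n) : digitVec n (2 ^ (i : ℕ)) = Pi.single i 1 := by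
  ext j
  simp [digitVec, Nat.testBit_two_pow, Pi.single_apply, Fin.ext_iff, eq_comm]

/-- The Walsh function with index `2^i` reads off the digit `i`. -/
theorem binPoint_injective (n : ℕ) : Function.Injective (binPoint (n := n)) := by
  intro y z h
  ext1 i
  have := congrArg (wal n (2 ^ (i : ℕ))) h
  rw [wal_binPoint le_rfl, wal_binPoint le_rfl, digitVec_two_pow, single_one_dotProduct,
    single_one_dotProduct] at this
  exact chi_injective this

theorem exists_digitVec_eq {m : ℕ} (v : Fin m → ZMod 2) : ∃ h < 2 ^ m, digitVec m h = v := by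
  refine ⟨Nat.ofBits fun i => decide (v i = 1), Nat.ofBits_lt_two_pow _, ?_⟩
  ext i
  rcases zmod_two_cases (v i) with h | h <;> simp [digitVec, h]

/-- The point of the net that belongs to the vector `v` of digits. -/
def vecPoint {s n m : ℕ} (C : Fin s → Matrix (Fin n) (Fin m) (ZMod 2)) (v : Fin m → ZMod 2) :
    Fin s → ℝ := fun j => binPoint ((C j).mulVec v)

theorem vecPoint_mem {s n m : ℕ} (C : Fin s → Matrix (Fin n) (Fin m) (ZMod 2))
    (v : Fin m → ZMod 2) (j : Fin s) : vecPoint C v j ∈ Ico (0 : ℝ) 1 := binPoint_mem _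

open Classical in
theorem digitalNet_eq_image {s n m : ℕ} (C : Fin s → Matrix (Fin n) (Fin m) (ZMod 2)) :
    digitalNet C = Finset.univ.image (vecPoint C) := by
  ext x
  simp only [digitalNet, Finset.mem_image, Finset.mem_range, Finset.mem_univ, true_and]
  constructor
  · rintro ⟨h, _, rfl⟩
    exact ⟨digitVec m h, rfl⟩
  · rintro ⟨v, rfl⟩
    obtain ⟨h, hh, rfl⟩ := exists_digitVec_eq v
    exact ⟨h, hh, rfl⟩

/-- The homomorphism that maps `v` to the digits of the point that belongs to `v`. -/
def netHom {s n m : ℕ} (C : Fin s → Matrix (Fin n) (Fin m) (ZMod 2)) :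
    (Fin m → ZMod 2) →+ (Fin s → Fin n → ZMod 2) where
  toFun v j := (C j).mulVec v
  map_zero' := by ext; simp
  map_add' v w := by ext; simp [Matrix.mulVec_add]

theorem vecPoint_eq_iff {s n m : ℕ} (C : Fin s → Matrix (Fin n) (Fin m) (ZMod 2))
    (v w : Fin m → ZMod 2) : vecPoint C v = vecPoint C w ↔ netHom C v = netHom C w := by
  simp only [funext_iff (f := vecPoint C v), funext_iff (f := netHom C v)]
  exact forall_congr' fun j => (binPoint_injective n).eq_iff

/-- The net is a set, and distinct `v` may give the same point. The fibres of `netHom C` over its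
range all have the size of its kernel, so the average is unaffected. -/
theorem quadrature_digitalNet {s n m : ℕ} (C : Fin s → Matrix (Fin n) (Fin m) (ZMod 2))
    (F : (Fin s → ℝ) → ℝ) :
    quadrature (digitalNet C) F = 1 / 2 ^ m * ∑ v : Fin m → ZMod 2, F (vecPoint C v) := by
  classical
  set c : ℕ := Finset.card {v : Fin m → ZMod 2 | netHom C v = 0}
  have hc : 0 < c := Finset.card_pos.2 ⟨0, by simp⟩
  have key : ∀ G : (Fin s → ℝ) → ℝ,
      ∑ v : Fin m → ZMod 2, G (vecPoint C v) = c * ∑ x ∈ digitalNet C, G x := by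
    intro G
    rw [Finset.sum_comp G (vecPoint C), digitalNet_eq_image, Finset.mul_sum]
    refine Finset.sum_congr rfl fun x hx => ?_
    obtain ⟨w, -, rfl⟩ := Finset.mem_image.1 hx
    simp_rw [vecPoint_eq_iff]
    rw [AddMonoidHom.card_fiber_eq_of_mem_range (netHom C) ⟨w, rfl⟩ ⟨0, map_zero _⟩, nsmul_eq_mul]
  have h1 := key fun _ => 1
  simp only [Finset.sum_const, Finset.card_univ, Fintype.card_pi, ZMod.card, Finset.prod_const,
    Fintype.card_fin, nsmul_eq_mul, mul_one] at h1
  push_cast at h1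
  have hP : ((digitalNet C).card : ℝ) ≠ 0 := by
    intro h0
    rw [h0, mul_zero] at h1
    exact pow_ne_zero m two_ne_zero h1
  rw [quadrature, key F, h1]
  have : (c : ℝ) ≠ 0 := by exact_mod_cast hc.ne'
  field_simp

/-- Orthogonality of characters: the average over `v` of `chi (c ⬝ᵥ v)` is 1 if `c = 0` and 0
otherwise, and `c = 0` is the condition defining the dual net. -/
theorem quadrature_wal {s n m N : ℕ} (hN : n ≤ N) (C : Fin s → Matrix (Fin n) (Fin m) (ZMod 2))
    (k : Fin s → ℕ) [Decidable (k ∈ dualNet C)] :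
    quadrature (digitalNet C) (fun x => ∏ j, wal N (k j) (x j))
      = if k ∈ dualNet C then 1 else 0 := by
  classical
  set c : Fin m → ZMod 2 := ∑ j, (C j).transpose.mulVec (digitVec n (k j)) with hc
  let φ : (Fin m → ZMod 2) →+ ZMod 2 :=
    { toFun := fun v => c ⬝ᵥ v
      map_zero' := dotProduct_zero c
      map_add' := dotProduct_add c }
  have h1 : ∀ v, ∏ j, wal N (k j) (vecPoint C v j) = chi.compAddMonoidHom φ v := by
    intro v
    change _ = chi (c ⬝ᵥ v)
    rw [hc, sum_dotProduct, chi_sum]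
    refine Finset.prod_congr rfl fun j _ => ?_
    rw [vecPoint, wal_binPoint hN, Matrix.dotProduct_mulVec, Matrix.mulVec_transpose]
  have h2 : chi.compAddMonoidHom φ = 0 ↔ k ∈ dualNet C := by
    change _ ↔ c = 0
    constructor
    · intro h
      ext i
      have := DFunLike.congr_fun h (Pi.single i 1)
      change chi (c ⬝ᵥ Pi.single i 1) = 1 at this
      rw [dotProduct_single_one, ← AddChar.map_zero_eq_one chi] at this
      exact chi_injective this
    · intro h
      ext v
      change chi (c ⬝ᵥ v) = 1
      simp [h]
  rw [quadrature_digitalNet]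
  simp_rw [h1]
  rw [AddChar.sum_eq_ite]
  simp only [h2]
  split_ifs <;> simp

/-! ### Integration over the unit cube, one coordinate at a time -/

/-- Lebesgue measure on the unit interval. -/
def unitMeasure : Measure ℝ := volume.restrict (Ioc 0 1)

instance : IsProbabilityMeasure unitMeasure := ⟨by simp [unitMeasure]⟩

/-- Lebesgue measure on the unit cube. -/
def cubeMeasure (s : ℕ) : Measure (Fin s → ℝ) := Measure.pi fun _ => unitMeasure

instance (s : ℕ) : IsProbabilityMeasure (cubeMeasure s) := by
  unfold cubeMeasure; infer_instance

theorem integral_unitMeasure (f : ℝ → ℝ) : ∫ x, f x ∂unitMeasure = ∫ x in (0 : ℝ)..1, f x := by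
  rw [intervalIntegral.integral_of_le zero_le_one, unitMeasure]

theorem restrict_cube (s : ℕ) : volume.restrict (cube s) = cubeMeasure s := by
  rw [cube, volume_pi, Measure.restrict_pi_pi, cubeMeasure]
  congr 1; ext1 i
  exact (Measure.restrict_congr_set Ioc_ae_eq_Icc).symm

theorem restrict_hoCube (s : ℕ) : volume.restrict (hoCube s) = cubeMeasure s := by
  rw [hoCube, volume_pi, Measure.restrict_pi_pi, cubeMeasure]
  congr 1; ext1 i
  exact Measure.restrict_congr_set Ico_ae_eq_Ioc

theorem integral_eq_integral_cubeMeasure {s : ℕ} (f : (Fin s → ℝ) → ℝ) :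
    integral f = ∫ x, f x ∂cubeMeasure s := by
  rw [integral, restrict_hoCube]

theorem measurableSet_cube (s : ℕ) : MeasurableSet (cube s) :=
  MeasurableSet.univ_pi fun _ => measurableSet_Icc

theorem isCompact_cube (s : ℕ) : IsCompact (cube s) := isCompact_univ_pi fun _ => isCompact_Icc

theorem ae_mem_cube (s : ℕ) : ∀ᵐ x ∂cubeMeasure s, x ∈ cube s := by
  rw [← restrict_cube]; exact ae_restrict_mem (measurableSet_cube s)

theorem update_mem_cube {s : ℕ} {y : Fin s → ℝ} (hy : y ∈ cube s) (j : Fin s) {t : ℝ}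
    (ht : t ∈ Icc (0 : ℝ) 1) : Function.update y j t ∈ cube s := by
  intro i _
  rcases eq_or_ne i j with rfl | h
  · simpa using ht
  · simpa [h] using hy i trivial

/-- Replacing one coordinate by a fresh independent uniform one preserves the measure. This gives
Fubini in the variable `j` without splitting the index type. -/
theorem measurePreserving_update {s : ℕ} (j : Fin s) :
    MeasurePreserving (fun p : (Fin s → ℝ) × ℝ => Function.update p.1 j p.2)
      ((cubeMeasure s).prod unitMeasure) (cubeMeasure s) := by
  have hm : Measurable fun p : (Fin s → ℝ) × ℝ => Function.update p.1 j p.2 := by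
    refine measurable_pi_lambda _ fun i => ?_
    rcases eq_or_ne i j with rfl | h
    · simpa using measurable_snd
    · simp only [Function.update_of_ne h]; fun_prop
  refine ⟨hm, (Measure.pi_eq fun S hS => ?_).symm⟩
  rw [Measure.map_apply hm (MeasurableSet.univ_pi hS)]
  have : (fun p : (Fin s → ℝ) × ℝ => Function.update p.1 j p.2) ⁻¹' (univ.pi S)
      = (univ.pi (Function.update S j univ)) ×ˢ S j := by
    ext ⟨y, t⟩
    simp only [mem_preimage, mem_univ_pi, mem_prod]
    constructor
    · intro h
      refine ⟨fun i => ?_, by simpa using h j⟩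
      rcases eq_or_ne i j with rfl | hi
      · simp
      · simpa [hi] using h i
    · rintro ⟨h, ht⟩ i
      rcases eq_or_ne i j with rfl | hi
      · simpa using ht
      · simpa [hi] using h i
  rw [this, Measure.prod_prod, cubeMeasure, Measure.pi_pi,
    ← Finset.mul_prod_erase _ _ (Finset.mem_univ j),
    ← Finset.mul_prod_erase _ (fun i => unitMeasure (S i)) (Finset.mem_univ j)]
  rw [Function.update_self, measure_univ, one_mul, mul_comm]
  congr 1
  refine Finset.prod_congr rfl fun i hi => ?_
  rw [Function.update_of_ne (Finset.ne_of_mem_erase hi)]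

theorem integral_update {s : ℕ} (j : Fin s) {G : (Fin s → ℝ) → ℝ}
    (hG : Integrable G (cubeMeasure s)) :
    ∫ y, G y ∂cubeMeasure s
      = ∫ y, (∫ t in (0 : ℝ)..1, G (Function.update y j t)) ∂cubeMeasure s := by
  have hp := measurePreserving_update j
  simp_rw [← integral_unitMeasure]
  have h2 : Integrable (fun p : (Fin s → ℝ) × ℝ => G (Function.update p.1 j p.2))
      ((cubeMeasure s).prod unitMeasure) := hp.integrable_comp_of_integrable hG
  rw [← integral_prod _ h2]
  conv_lhs => rw [← hp.map_eq]
  exact integral_map hp.aemeasurable (by rw [hp.map_eq]; exact hG.aestronglyMeasurable)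

theorem integrable_cubeMeasure {s : ℕ} {g : (Fin s → ℝ) → ℝ} (hg : ContinuousOn g (cube s)) :
    Integrable g (cubeMeasure s) := by
  rw [← restrict_cube]
  exact hg.integrableOn_compact (isCompact_cube s)

theorem integrable_mul_of_abs_le {s : ℕ} {g φ : (Fin s → ℝ) → ℝ} {c : ℝ}
    (hg : ContinuousOn g (cube s)) (hφ : Measurable φ) (hb : ∀ y ∈ cube s, |φ y| ≤ c) :
    Integrable (fun y => g y * φ y) (cubeMeasure s) :=
  (integrable_cubeMeasure hg).mul_bdd (c := c) hφ.aestronglyMeasurable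
    ((ae_mem_cube s).mono fun y hy => hb y hy)

theorem measurable_prod_apply {s : ℕ} {a : Fin s → ℝ → ℝ} (ha : ∀ i, Measurable (a i))
    (S : Finset (Fin s)) : Measurable fun y : Fin s → ℝ => ∏ i ∈ S, a i (y i) :=
  Finset.measurable_fun_prod _ fun i _ => (ha i).comp (measurable_pi_apply i)

theorem abs_prod_apply_le {s : ℕ} {a : Fin s → ℝ → ℝ} {c : Fin s → ℝ}
    (hc : ∀ i, ∀ x ∈ Icc (0 : ℝ) 1, |a i x| ≤ c i) (S : Finset (Fin s)) {y : Fin s → ℝ}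
    (hy : y ∈ cube s) : |∏ i ∈ S, a i (y i)| ≤ ∏ i ∈ S, c i := by
  rw [Finset.abs_prod]
  exact Finset.prod_le_prod (fun i _ => abs_nonneg _) fun i _ => hc i _ (hy i trivial)

/-! ### Partial derivatives on the cube -/

theorem uniqueDiffOn_cube (s : ℕ) : UniqueDiffOn ℝ (cube s) :=
  UniqueDiffOn.univ_pi fun _ => uniqueDiffOn_Icc_zero_one

theorem contDiffOn_slice {s : ℕ} {g : (Fin s → ℝ) → ℝ} (hg : ContDiffOn ℝ ∞ g (cube s))
    (j : Fin s) {y : Fin s → ℝ} (hy : y ∈ cube s) :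
    ContDiffOn ℝ ∞ (fun t => g (Function.update y j t)) (Icc 0 1) :=
  hg.comp (contDiff_update ∞ y j).contDiffOn fun _ ht => update_mem_cube hy j ht

/-- The link to the Fréchet derivative is what shows that partial derivatives are again smooth up to
the boundary. -/
theorem pderiv_eq_fderivWithin {s : ℕ} {g : (Fin s → ℝ) → ℝ} (hg : ContDiffOn ℝ ∞ g (cube s))
    (j : Fin s) {x : Fin s → ℝ} (hx : x ∈ cube s) :
    pderiv j g x = fderivWithin ℝ g (cube s) x (Pi.single j 1) := by
  have h1 : HasFDerivWithinAt g (fderivWithin ℝ g (cube s) x) (cube s)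
      (Function.update x j (x j)) := by
    rw [Function.update_eq_self]
    exact ((hg.differentiableOn (by simp)) x hx).hasFDerivWithinAt
  have h2 := h1.comp_hasDerivWithinAt (x j) (hasDerivAt_update x j (x j)).hasDerivWithinAt
    (fun t ht => update_mem_cube hx j ht)
  exact h2.derivWithin (uniqueDiffOn_Icc_zero_one _ (hx j trivial))

theorem contDiffOn_pderiv {s : ℕ} {g : (Fin s → ℝ) → ℝ} (hg : ContDiffOn ℝ ∞ g (cube s))
    (j : Fin s) : ContDiffOn ℝ ∞ (pderiv j g) (cube s) :=
  ((hg.fderivWithin (uniqueDiffOn_cube s) (by simp)).clm_apply contDiffOn_const).congr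
    fun _ hx => pderiv_eq_fderivWithin hg j hx

theorem contDiffOn_iterate_pderiv {s : ℕ} {g : (Fin s → ℝ) → ℝ}
    (hg : ContDiffOn ℝ ∞ g (cube s)) (j : Fin s) (i : ℕ) :
    ContDiffOn ℝ ∞ ((pderiv j)^[i] g) (cube s) := by
  induction i with
  | zero => exact hg
  | succ i ih => rw [Function.iterate_succ_apply']; exact contDiffOn_pderiv ih j

theorem isDerivSeq_iterate_pderiv {s : ℕ} {g : (Fin s → ℝ) → ℝ}
    (hg : ContDiffOn ℝ ∞ g (cube s)) (j : Fin s) {y : Fin s → ℝ} (hy : y ∈ cube s) :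
    IsDerivSeq fun i t => (pderiv j)^[i] g (Function.update y j t) := by
  intro i t ht
  have h := (((contDiffOn_slice (contDiffOn_iterate_pderiv hg j i) j hy).differentiableOn
    (by simp)) t ht).hasDerivWithinAt
  simp only [Function.iterate_succ_apply', pderiv, Function.update_idem, Function.update_self]
  exact h

/-- The mixed derivative that differentiates only in the variables of a list. -/
def listPartial {s : ℕ} (α : Fin s → ℕ) (l : List (Fin s)) (f : (Fin s → ℝ) → ℝ) :
    (Fin s → ℝ) → ℝ :=
  l.foldr (fun j g => (pderiv j)^[α j] g) f

theorem listPartial_cons {s : ℕ} (α : Fin s → ℕ) (j : Fin s) (l : List (Fin s))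
    (f : (Fin s → ℝ) → ℝ) :
    listPartial α (j :: l) f = (pderiv j)^[α j] (listPartial α l f) := rfl

theorem contDiffOn_listPartial {s : ℕ} {f : (Fin s → ℝ) → ℝ} (hf : ContDiffOn ℝ ∞ f (cube s))
    (α : Fin s → ℕ) (l : List (Fin s)) : ContDiffOn ℝ ∞ (listPartial α l f) (cube s) := by
  induction l with
  | nil => exact hf
  | cons j l ih => rw [listPartial_cons]; exact contDiffOn_iterate_pderiv ih j _

/-! ### Walsh coefficients of smooth functions on the cube -/

/-- Replacing the Walsh function in one variable by its kernel. -/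
theorem integral_mul_wal_mul_prod {s : ℕ} {g : (Fin s → ℝ) → ℝ} (hg : ContDiffOn ℝ ∞ g (cube s))
    (j : Fin s) {N k : ℕ} {W : ℝ → ℝ} (hW : Continuous W)
    (hF : ∀ F, IsDerivSeq F → ∫ x in (0 : ℝ)..1, F 0 x * wal N k x
        = (-1) ^ bitCount N k * ∫ x in (0 : ℝ)..1, F (bitCount N k) x * W x)
    {a : Fin s → ℝ → ℝ} {c : Fin s → ℝ} {d : ℝ} (ha : ∀ i, Measurable (a i))
    (hd : ∀ x ∈ Icc (0 : ℝ) 1, |W x| ≤ d)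
    (hc : ∀ i, ∀ x ∈ Icc (0 : ℝ) 1, |a i x| ≤ c i) :
    ∫ y, g y * (wal N k (y j) * ∏ i ∈ Finset.univ.erase j, a i (y i)) ∂cubeMeasure s
      = (-1) ^ bitCount N k * ∫ y, (pderiv j)^[bitCount N k] g y
          * (W (y j) * ∏ i ∈ Finset.univ.erase j, a i (y i)) ∂cubeMeasure s := by
  set v := bitCount N k
  set φ : (Fin s → ℝ) → ℝ := fun y => ∏ i ∈ Finset.univ.erase j, a i (y i) with hφ
  have hφm : Measurable φ := measurable_prod_apply ha _
  have hφb : ∀ y ∈ cube s, |φ y| ≤ ∏ i ∈ Finset.univ.erase j, c i :=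
    fun y hy => abs_prod_apply_le hc _ hy
  have hφu : ∀ y t, φ (Function.update y j t) = φ y := fun y t =>
    Finset.prod_congr rfl fun i hi => by rw [Function.update_of_ne (Finset.ne_of_mem_erase hi)]
  have i1 : Integrable (fun y => g y * (wal N k (y j) * φ y)) (cubeMeasure s) := by
    refine integrable_mul_of_abs_le (c := 1 * ∏ i ∈ Finset.univ.erase j, c i) hg.continuousOn
      (((measurable_wal N k).comp (measurable_pi_apply j)).mul hφm) fun y hy => ?_
    rw [abs_mul, abs_wal]
    exact mul_le_mul_of_nonneg_left (hφb y hy) zero_le_one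
  have i2 : Integrable (fun y => (pderiv j)^[v] g y * (W (y j) * φ y)) (cubeMeasure s) := by
    refine integrable_mul_of_abs_le (c := d * ∏ i ∈ Finset.univ.erase j, c i)
      (contDiffOn_iterate_pderiv hg j v).continuousOn
      ((hW.measurable.comp (measurable_pi_apply j)).mul hφm) fun y hy => ?_
    rw [abs_mul]
    exact mul_le_mul (hd _ (hy j trivial)) (hφb y hy) (abs_nonneg _)
      ((abs_nonneg _).trans (hd _ (hy j trivial)))
  rw [integral_update j i1, integral_update j i2, ← integral_const_mul]
  refine integral_congr_ae ((ae_mem_cube s).mono fun y hy => ?_)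
  have h := hF _ (isDerivSeq_iterate_pderiv hg j hy)
  simp only [Function.update_self, hφu, ← mul_assoc]
  rw [intervalIntegral.integral_mul_const, intervalIntegral.integral_mul_const, ← mul_assoc, ← h]
  rfl

theorem abs_integral_mul_prod_wal_le {s : ℕ} {f : (Fin s → ℝ) → ℝ}
    (hf : ContDiffOn ℝ ∞ f (cube s)) (N : ℕ) (k : Fin s → ℕ) :
    |∫ y, f y * ∏ j, wal N (k j) (y j) ∂cubeMeasure s|
      ≤ (∏ j, 2 * bitWeight 1 N (k j))
        * ∫ y, |mixedPartial (fun j => bitCount N (k j)) f y| ∂cubeMeasure s := by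
  choose W hWc _ hWb _ hWF using fun j => exists_walsh_kernel N (k j)
  have hWabs : ∀ j, ∀ x ∈ Icc (0 : ℝ) 1, |W j x| ≤ 2 * bitWeight 1 N (k j) := fun j x hx => by
    rw [abs_of_nonneg (hWb j x hx).1]; exact (hWb j x hx).2
  set α : Fin s → ℕ := fun j => bitCount N (k j) with hα
  -- The state after the variables in `l` have been treated: they carry the kernel, the others still
  -- the Walsh function. Each step changes the integral only by a sign, up to the derivative taken.
  set A : List (Fin s) → Fin s → ℝ → ℝ := fun l i => if i ∈ l then W i else wal N (k i) with hA
  have hAm : ∀ l i, Measurable (A l i) := fun l i => by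
    simp only [hA]; split_ifs
    exacts [(hWc i).measurable, measurable_wal N (k i)]
  have hAb : ∀ l i, ∀ x ∈ Icc (0 : ℝ) 1, |A l i x| ≤ max 1 (2 * bitWeight 1 N (k i)) := by
    intro l i x hx
    simp only [hA]; split_ifs
    · exact (hWabs i x hx).trans (le_max_right _ _)
    · rw [abs_wal]; exact le_max_left _ _
  have key : ∀ l : List (Fin s), l.Nodup →
      |∫ y, f y * ∏ j, wal N (k j) (y j) ∂cubeMeasure s|
        = |∫ y, listPartial α l f y * ∏ j, A l j (y j) ∂cubeMeasure s| := by
    intro l hl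
    induction l with
    | nil => simp [hA, listPartial]
    | cons j l ih =>
      obtain ⟨hjl, hl'⟩ := List.nodup_cons.1 hl
      rw [ih hl']
      have e1 : ∀ y : Fin s → ℝ, ∏ i, A l i (y i)
          = wal N (k j) (y j) * ∏ i ∈ Finset.univ.erase j, A l i (y i) := fun y => by
        rw [← Finset.mul_prod_erase _ _ (Finset.mem_univ j)]
        simp only [hA, if_neg hjl]
      have e2 : ∀ y : Fin s → ℝ, ∏ i, A (j :: l) i (y i)
          = W j (y j) * ∏ i ∈ Finset.univ.erase j, A l i (y i) := fun y => by
        rw [← Finset.mul_prod_erase _ _ (Finset.mem_univ j)]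
        congr 1
        · simp [hA]
        · refine Finset.prod_congr rfl fun i hi => ?_
          simp [hA, Finset.ne_of_mem_erase hi]
      simp_rw [e1, e2]
      rw [integral_mul_wal_mul_prod (contDiffOn_listPartial hf α l) j (hWc j) (hWF j) (hAm l)
        (hWabs j) (hAb l), abs_mul, abs_pow, abs_neg, abs_one, one_pow, one_mul, listPartial_cons]
  rw [key _ (List.nodup_finRange s)]
  have hAl : ∀ j, A (List.finRange s) j = W j := fun j => by simp [hA]
  simp_rw [hAl]
  change |∫ y, mixedPartial α f y * ∏ j, W j (y j) ∂cubeMeasure s| ≤ _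
  rw [← integral_const_mul]
  have hcont : ContinuousOn (mixedPartial α f) (cube s) :=
    (contDiffOn_listPartial hf α (List.finRange s)).continuousOn
  refine (abs_integral_le_integral_abs).trans (integral_mono_ae ?_ ?_ ?_)
  · exact (integrable_mul_of_abs_le hcont (measurable_prod_apply (fun i => (hWc i).measurable) _)
      fun y hy => abs_prod_apply_le hWabs _ hy).abs
  · exact (integrable_cubeMeasure hcont).abs.const_mul _
  · refine (ae_mem_cube s).mono fun y hy => ?_
    simp only [abs_mul]
    rw [mul_comm]
    exact mul_le_mul_of_nonneg_right (abs_prod_apply_le hWabs _ hy) (abs_nonneg _)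

theorem integral_abs_mixedPartial_le {s : ℕ} {u : Fin s → ℝ} (hu : ∀ j, 0 < u j)
    {f : (Fin s → ℝ) → ℝ} (hf : ContDiffOn ℝ ∞ f (cube s)) (h1 : smoothNorm u f ≤ 1)
    (α : Fin s → ℕ) : ∫ y, |mixedPartial α f y| ∂cubeMeasure s ≤ ∏ j, u j ^ α j := by
  have hpos : 0 < ∏ j, u j ^ α j := Finset.prod_pos fun j _ => pow_pos (hu j) _
  have h2 := (le_iSup (fun α : Fin s → ℕ => eLpNorm (mixedPartial α f) 1
    (volume.restrict (cube s)) / ENNReal.ofReal (∏ j, u j ^ α j)) α).trans h1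
  rw [ENNReal.div_le_iff (by simpa using hpos) ENNReal.ofReal_ne_top, one_mul, restrict_cube,
    eLpNorm_one_eq_lintegral_enorm] at h2
  have hi : Integrable (mixedPartial α f) (cubeMeasure s) :=
    integrable_cubeMeasure (contDiffOn_listPartial hf α (List.finRange s)).continuousOn
  have h3 := integral_norm_eq_lintegral_enorm hi.aestronglyMeasurable
  simp only [Real.norm_eq_abs] at h3
  rw [h3]
  exact ENNReal.toReal_le_of_le_ofReal hpos.le h2

/-- The bound on the Walsh coefficients of the functions in the unit ball. -/
theorem abs_walshCoeff_le {s : ℕ} {u : Fin s → ℝ} (hu : ∀ j, 0 < u j)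
    {f : (Fin s → ℝ) → ℝ} (hf : ContDiffOn ℝ ∞ f (cube s)) (h1 : smoothNorm u f ≤ 1)
    (N : ℕ) (k : Fin s → ℕ) :
    |∫ y, f y * ∏ j, wal N (k j) (y j) ∂cubeMeasure s|
      ≤ 2 ^ s * ∏ j, bitWeight (u j) N (k j) := by
  have hw : ∀ j, 0 ≤ bitWeight 1 N (k j) := fun j => bitWeight_nonneg zero_le_one _ _
  refine (abs_integral_mul_prod_wal_le hf N k).trans ?_
  refine (mul_le_mul_of_nonneg_left (integral_abs_mixedPartial_le hu hf h1 _)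
    (Finset.prod_nonneg fun j _ => mul_nonneg zero_le_two (hw j))).trans_eq ?_
  rw [Finset.prod_mul_distrib, mul_assoc, ← Finset.prod_mul_distrib]
  simp only [Finset.prod_const, Finset.card_univ, Fintype.card_fin]
  congr 1
  exact Finset.prod_congr rfl fun j _ => by rw [bitWeight_eq_pow_mul (u j), mul_comm]

open Filter Topology

/-! ### The weights of the generalized WAFOM -/

theorem two_rpow_neg_mu {s : ℕ} {u : Fin s → ℝ} (hu : ∀ j, 0 < u j) {N : ℕ} {k : Fin s → ℕ}
    (hk : ∀ j, k j < 2 ^ N) : (2 : ℝ) ^ (-mu u k) = ∏ j, bitWeight (u j) N (k j) := by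
  rw [mu, ← Finset.sum_neg_distrib, Real.rpow_sum_of_pos two_pos]
  refine Finset.prod_congr rfl fun j _ => ?_
  rw [← Finset.sum_neg_distrib, Real.rpow_sum_of_pos two_pos,
    bitWeight_eq_of_lt (u j) (Nat.size_le.2 (hk j)) (Nat.lt_size_self _), bitWeight]
  refine Finset.prod_congr rfl fun i _ => ?_
  split_ifs with h
  -- Bits are counted from 0 here, so the exponent `i + 1` of the definition of `μ_u` becomes `i +
  -- 2`.
  · have h2 : -((((i + 1 : ℕ) : ℝ) + 1 - Real.logb 2 (u j)) * (((k j).testBit i).toNat : ℝ))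
        = Real.logb 2 (u j) - ((i + 2 : ℕ) : ℝ) := by
      simp only [h, Bool.toNat_true]; push_cast; ring
    rw [h2, Real.rpow_sub two_pos, Real.rpow_logb two_pos (by norm_num) (hu j), Real.rpow_natCast]
  · simp [h]

/-- The vectors of indices below `2^N`. -/
def dyadicBox (s N : ℕ) : Finset (Fin s → ℕ) := Fintype.piFinset fun _ => Finset.range (2 ^ N)

theorem mem_dyadicBox {s N : ℕ} {k : Fin s → ℕ} : k ∈ dyadicBox s N ↔ ∀ j, k j < 2 ^ N := by
  simp [dyadicBox]

theorem exists_forall_subset_dyadicBox {s : ℕ} (S : Finset (Fin s → ℕ)) :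
    ∃ N₀, ∀ N ≥ N₀, S ⊆ dyadicBox s N := by
  refine ⟨S.sup fun k => Finset.univ.sup k, fun N hN k hk => mem_dyadicBox.2 fun j => ?_⟩
  have h1 : k j ≤ Finset.univ.sup k := Finset.le_sup (Finset.mem_univ j)
  have h2 : Finset.univ.sup k ≤ S.sup fun k => Finset.univ.sup k :=
    Finset.le_sup (f := fun k : Fin s → ℕ => Finset.univ.sup k) hk
  exact (h1.trans (h2.trans hN)).trans_lt Nat.lt_two_pow_self

theorem sum_dyadicBox_two_rpow_neg_mu_le {s : ℕ} {u : Fin s → ℝ} (hu : ∀ j, 0 < u j) (N : ℕ) :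
    ∑ k ∈ dyadicBox s N, (2 : ℝ) ^ (-mu u k) ≤ ∏ j, Real.exp (u j / 2) := by
  rw [Finset.sum_congr rfl fun k hk => two_rpow_neg_mu hu (mem_dyadicBox.1 hk), dyadicBox,
    ← Finset.prod_univ_sum (fun _ : Fin s => Finset.range (2 ^ N))
      (fun j i => bitWeight (u j) N i)]
  exact Finset.prod_le_prod
    (fun j _ => Finset.sum_nonneg fun _ _ => bitWeight_nonneg (hu j).le _ _)
    fun j _ => sum_bitWeight_le (hu j).le N

theorem summable_two_rpow_neg_mu {s : ℕ} {u : Fin s → ℝ} (hu : ∀ j, 0 < u j) :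
    Summable fun k : Fin s → ℕ => (2 : ℝ) ^ (-mu u k) := by
  refine summable_of_sum_le (c := ∏ j, Real.exp (u j / 2)) (fun k => by positivity) fun S => ?_
  obtain ⟨N, hN⟩ := exists_forall_subset_dyadicBox S
  exact (Finset.sum_le_sum_of_subset_of_nonneg (hN N le_rfl) fun _ _ _ => by positivity).trans
    (sum_dyadicBox_two_rpow_neg_mu_le hu N)

/-! ### The integration error as a limit of sums of Walsh coefficients -/

/-- The Walsh coefficient of `f` with index `k`, for the Walsh functions of level `N`. -/
def walshCoeff {s : ℕ} (f : (Fin s → ℝ) → ℝ) (N : ℕ) (k : Fin s → ℕ) : ℝ :=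
  ∫ y, f y * ∏ j, wal N (k j) (y j) ∂cubeMeasure s

theorem integrable_mul_prod_wal {s : ℕ} {f : (Fin s → ℝ) → ℝ} (hf : ContinuousOn f (cube s))
    (N : ℕ) (k : Fin s → ℕ) :
    Integrable (fun y => f y * ∏ j, wal N (k j) (y j)) (cubeMeasure s) :=
  integrable_mul_of_abs_le hf (measurable_prod_apply (fun j => measurable_wal N (k j)) _)
    fun _ hy => abs_prod_apply_le (c := fun _ => 1) (fun _ _ _ => (abs_wal _ _ _).le) _ hy

theorem walshCoeff_zero {s : ℕ} (f : (Fin s → ℝ) → ℝ) (N : ℕ) :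
    walshCoeff f N 0 = integral f := by
  simp [walshCoeff, wal_zero_right, integral_eq_integral_cubeMeasure]

theorem prod_walKernel {s : ℕ} (N : ℕ) (x y : Fin s → ℝ) :
    ∏ j, walKernel N (x j) (y j)
      = ∑ k ∈ dyadicBox s N, (∏ j, wal N (k j) (x j)) * ∏ j, wal N (k j) (y j) := by
  simp_rw [walKernel, ← Finset.prod_mul_distrib]
  exact Finset.prod_univ_sum (fun _ : Fin s => Finset.range (2 ^ N))
    fun j i => wal N i (x j) * wal N i (y j)

theorem integral_mul_prod_walKernel {s : ℕ} {f : (Fin s → ℝ) → ℝ} (hf : ContinuousOn f (cube s))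
    (N : ℕ) (x : Fin s → ℝ) :
    ∫ y, f y * ∏ j, walKernel N (x j) (y j) ∂cubeMeasure s
      = ∑ k ∈ dyadicBox s N, (∏ j, wal N (k j) (x j)) * walshCoeff f N k := by
  simp_rw [prod_walKernel, Finset.mul_sum, mul_left_comm (f _)]
  rw [integral_finsetSum _ fun k _ => (integrable_mul_prod_wal hf N k).const_mul _]
  simp_rw [integral_const_mul]
  rfl

theorem integral_prod_walKernel {s : ℕ} (N : ℕ) (x : Fin s → ℝ) :
    ∫ y, ∏ j, walKernel N (x j) (y j) ∂cubeMeasure s = 1 := by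
  rw [cubeMeasure, integral_fintype_prod_eq_prod (f := fun j t => walKernel N (x j) t)]
  simp [integral_unitMeasure, integral_walKernel]

theorem tendsto_integral_mul_prod_walKernel {s : ℕ} {f : (Fin s → ℝ) → ℝ}
    (hf : ContinuousOn f (cube s)) {x : Fin s → ℝ} (hx : x ∈ cube s) :
    Tendsto (fun N => ∫ y, f y * ∏ j, walKernel N (x j) (y j) ∂cubeMeasure s) atTop
      (𝓝 (f x)) := by
  rw [Metric.tendsto_atTop]
  intro ε hε
  obtain ⟨δ, hδ, hfδ⟩ := Metric.continuousOn_iff.1 hf x hx (ε / 2) (by positivity)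
  obtain ⟨N₀, hN₀⟩ := exists_pow_lt_of_lt_one hδ (show (2⁻¹ : ℝ) < 1 by norm_num)
  refine ⟨N₀, fun N hN => ?_⟩
  have hNδ : (2⁻¹ : ℝ) ^ N < δ :=
    (pow_le_pow_of_le_one (by norm_num) (by norm_num) hN).trans_lt hN₀
  set K : (Fin s → ℝ) → ℝ := fun y => ∏ j, walKernel N (x j) (y j) with hK
  have hK0 : ∀ y, 0 ≤ K y := fun y => Finset.prod_nonneg fun j _ => walKernel_nonneg _ _ _
  have hint : ∀ {g : (Fin s → ℝ) → ℝ}, ContinuousOn g (cube s) →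
      Integrable (fun y => g y * K y) (cubeMeasure s) := by
    intro g hg
    simp_rw [hK, prod_walKernel, Finset.mul_sum, mul_left_comm (g _)]
    exact integrable_finsetSum _ fun k _ => (integrable_mul_prod_wal hg N k).const_mul _
  have hK1 : ∀ c : ℝ, ∫ y, c * K y ∂cubeMeasure s = c := fun c => by
    rw [integral_const_mul, integral_prod_walKernel, mul_one]
  have hpt : ∀ y ∈ cube s, |(f y - f x) * K y| ≤ ε / 2 * K y := by
    intro y hy
    rw [abs_mul, abs_of_nonneg (hK0 y)]
    -- Either `y` is within `2^{-N} < δ` of `x` in every coordinate, where continuity applies, or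
    -- one factor of the kernel vanishes.
    by_cases h : ∀ j, |x j - y j| ≤ (2⁻¹ : ℝ) ^ N
    · refine mul_le_mul_of_nonneg_right (hfδ y hy ?_).le (hK0 y)
      exact (dist_pi_lt_iff hδ).2 fun j => by
        rw [dist_comm, Real.dist_eq]; exact (h j).trans_lt hNδ
    · push Not at h
      obtain ⟨j, hj⟩ := h
      have : K y = 0 := Finset.prod_eq_zero (Finset.mem_univ j)
        (walKernel_eq_zero (hx j trivial) (hy j trivial) hj)
      simp [this]
  have hsub : ∫ y, f y * K y ∂cubeMeasure s - f x = ∫ y, (f y - f x) * K y ∂cubeMeasure s := by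
    rw [← hK1 (f x), ← integral_sub (hint hf) (hint continuousOn_const), hK1]
    simp_rw [sub_mul]
  rw [Real.dist_eq, hsub]
  calc |∫ y, (f y - f x) * K y ∂cubeMeasure s|
      ≤ ∫ y, |(f y - f x) * K y| ∂cubeMeasure s := abs_integral_le_integral_abs
    _ ≤ ∫ y, ε / 2 * K y ∂cubeMeasure s :=
        integral_mono_ae (hint (hf.sub continuousOn_const)).abs (hint continuousOn_const)
          ((ae_mem_cube s).mono hpt)
    _ < ε := by rw [hK1]; linarith

open Classical in
theorem quadrature_integral_walKernel {s n m N : ℕ} (hN : n ≤ N)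
    (C : Fin s → Matrix (Fin n) (Fin m) (ZMod 2)) {f : (Fin s → ℝ) → ℝ}
    (hf : ContinuousOn f (cube s)) :
    quadrature (digitalNet C) (fun x => ∫ y, f y * ∏ j, walKernel N (x j) (y j) ∂cubeMeasure s)
      = ∑ k ∈ dyadicBox s N with k ∈ dualNet C, walshCoeff f N k := by
  simp_rw [integral_mul_prod_walKernel hf]
  rw [quadrature, Finset.sum_comm, Finset.mul_sum, Finset.sum_filter]
  refine Finset.sum_congr rfl fun k _ => ?_
  rw [← Finset.sum_mul, ← mul_assoc]
  change quadrature (digitalNet C) (fun x => ∏ j, wal N (k j) (x j)) * _ = _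
  rw [quadrature_wal hN, ite_mul, one_mul, zero_mul]

theorem digitalNet_subset_cube {s n m : ℕ} (C : Fin s → Matrix (Fin n) (Fin m) (ZMod 2))
    {x : Fin s → ℝ} (hx : x ∈ digitalNet C) : x ∈ cube s := by
  classical
  rw [digitalNet_eq_image] at hx
  obtain ⟨v, -, rfl⟩ := Finset.mem_image.1 hx
  exact fun j _ => Ico_subset_Icc_self (vecPoint_mem C v j)

theorem zero_mem_dualNet {s n m : ℕ} (C : Fin s → Matrix (Fin n) (Fin m) (ZMod 2)) :
    0 ∈ dualNet C := by
  have : digitVec n 0 = 0 := by ext; simp [digitVec]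
  simp [dualNet, this]

-- Only continuity is needed, since the partial sums over boxes converge at each point of the net.
-- The index `k = 0` contributes exactly the integral, which the error subtracts.
open Classical in
theorem tendsto_sum_walshCoeff {s n m : ℕ} (C : Fin s → Matrix (Fin n) (Fin m) (ZMod 2))
    {f : (Fin s → ℝ) → ℝ} (hf : ContinuousOn f (cube s)) :
    Tendsto (fun N => ∑ k ∈ dyadicBox s N with k ∈ dualNet C \ {0}, walshCoeff f N k) atTop
      (𝓝 (err f (digitalNet C))) := by
  have h1 : Tendsto (fun N => quadrature (digitalNet C) (fun x => ∫ y, f y *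
      ∏ j, walKernel N (x j) (y j) ∂cubeMeasure s) - integral f) atTop
      (𝓝 (err f (digitalNet C))) :=
    ((tendsto_finsetSum _ fun x hx => tendsto_integral_mul_prod_walKernel hf
      (digitalNet_subset_cube C hx)).const_mul _).sub_const _
  refine h1.congr' ((eventually_ge_atTop n).mono fun N hN => ?_)
  rw [quadrature_integral_walKernel hN C hf]
  have h0 : (0 : Fin s → ℕ) ∈ (dyadicBox s N).filter (· ∈ dualNet C) :=
    Finset.mem_filter.2 ⟨mem_dyadicBox.2 fun j => by simp, zero_mem_dualNet C⟩
  rw [← Finset.add_sum_erase _ _ h0, walshCoeff_zero, add_sub_cancel_left]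
  refine Finset.sum_congr ?_ fun _ _ => rfl
  ext k
  simp only [Finset.mem_erase, Finset.mem_filter, Set.mem_sdiff, mem_singleton_iff]
  tauto

/-! ### The bounds on the worst-case error -/

theorem wafom_eq_tsum_indicator {s n m : ℕ} (u : Fin s → ℝ)
    (C : Fin s → Matrix (Fin n) (Fin m) (ZMod 2)) :
    wafom u C = ∑' k, (dualNet C \ {0}).indicator (fun k => (2 : ℝ) ^ (-mu u k)) k :=
  tsum_subtype (dualNet C \ {0}) fun k => (2 : ℝ) ^ (-mu u k)

theorem summable_wafomTerm {s n m : ℕ} {u : Fin s → ℝ} (hu : ∀ j, 0 < u j)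
    (C : Fin s → Matrix (Fin n) (Fin m) (ZMod 2)) : Summable (wafomTerm u C) :=
  (summable_two_rpow_neg_mu hu).subtype _

open Classical in
theorem sum_filter_le_wafom {s n m : ℕ} {u : Fin s → ℝ} (hu : ∀ j, 0 < u j)
    (C : Fin s → Matrix (Fin n) (Fin m) (ZMod 2)) (S : Finset (Fin s → ℕ)) :
    ∑ k ∈ S with k ∈ dualNet C \ {0}, (2 : ℝ) ^ (-mu u k) ≤ wafom u C := by
  rw [wafom_eq_tsum_indicator, Finset.sum_filter]
  refine le_trans (le_of_eq ?_) (((summable_two_rpow_neg_mu hu).indicator _).sum_le_tsum S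
    fun k _ => indicator_nonneg (fun _ _ => by positivity) k)
  exact Finset.sum_congr rfl fun k _ => by rw [indicator_apply]

theorem abs_err_le {s n m : ℕ} {u : Fin s → ℝ} (hu : ∀ j, 0 < u j)
    (C : Fin s → Matrix (Fin n) (Fin m) (ZMod 2)) {f : (Fin s → ℝ) → ℝ}
    (hf : ContDiffOn ℝ ∞ f (cube s)) (h1 : smoothNorm u f ≤ 1) :
    |err f (digitalNet C)| ≤ 2 ^ s * wafom u C := by
  classical
  refine le_of_tendsto' (tendsto_sum_walshCoeff C hf.continuousOn).abs fun N => ?_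
  calc |∑ k ∈ dyadicBox s N with k ∈ dualNet C \ {0}, walshCoeff f N k|
      ≤ ∑ k ∈ dyadicBox s N with k ∈ dualNet C \ {0}, |walshCoeff f N k| :=
        Finset.abs_sum_le_sum_abs _ _
    _ ≤ ∑ k ∈ dyadicBox s N with k ∈ dualNet C \ {0}, 2 ^ s * (2 : ℝ) ^ (-mu u k) := by
        refine Finset.sum_le_sum fun k hk => ?_
        rw [two_rpow_neg_mu hu (mem_dyadicBox.1 (Finset.mem_filter.1 hk).1)]
        exact abs_walshCoeff_le hu hf h1 N k
    _ ≤ 2 ^ s * wafom u C := by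
        rw [← Finset.mul_sum]
        gcongr
        exact sum_filter_le_wafom hu C _

/-! ### The extremal exponential function -/

theorem constA_eq {s : ℕ} (u : Fin s → ℝ) : constA u = ∏ j, expMean (u j) := rfl

theorem constB_eq {s : ℕ} (u : Fin s → ℝ) :
    constB u = ∏ j, ⨅ w : {w : ℕ // 1 ≤ w}, betaFactor (u j) w.1 := rfl

theorem constA_pos {s : ℕ} {u : Fin s → ℝ} (hu : ∀ j, 0 < u j) : 0 < constA u :=
  Finset.prod_pos fun j _ => expMean_pos (hu j)

theorem iInf_betaFactor_pos {u : ℝ} (hu : 0 < u) :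
    0 < ⨅ w : {w : ℕ // 1 ≤ w}, betaFactor u w.1 :=
  haveI : Nonempty {w : ℕ // 1 ≤ w} := ⟨⟨1, le_rfl⟩⟩
  (Real.exp_pos (-(2 * u))).trans_le (le_ciInf fun w => exp_neg_le_betaFactor hu w.1)

theorem constB_pos {s : ℕ} {u : Fin s → ℝ} (hu : ∀ j, 0 < u j) : 0 < constB u :=
  Finset.prod_pos fun j _ => iInf_betaFactor_pos (hu j)

theorem iInf_betaFactor_le {u : ℝ} (hu : 0 < u) {w : ℕ} (hw : 1 ≤ w) :
    ⨅ w : {w : ℕ // 1 ≤ w}, betaFactor u w.1 ≤ betaFactor u w :=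
  ciInf_le (f := fun w : {w : ℕ // 1 ≤ w} => betaFactor u w.1)
    ⟨0, by rintro _ ⟨w, rfl⟩; exact (betaFactor_pos hu w.1).le⟩ ⟨w, hw⟩

/-- The product of the `exp(-u_j x_j)`, normalized to have integral `1`. -/
def expProd {s : ℕ} (u : Fin s → ℝ) (x : Fin s → ℝ) : ℝ :=
  (constA u)⁻¹ * ∏ j, Real.exp (-(u j * x j))

theorem expProd_nonneg {s : ℕ} {u : Fin s → ℝ} (hu : ∀ j, 0 < u j) (x : Fin s → ℝ) :
    0 ≤ expProd u x :=
  mul_nonneg (inv_nonneg.2 (constA_pos hu).le) (Finset.prod_nonneg fun _ _ => (Real.exp_pos _).le)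

theorem contDiff_expProd {s : ℕ} (u : Fin s → ℝ) : ContDiff ℝ ∞ (expProd u) := by
  unfold expProd
  fun_prop

theorem integral_expProd {s : ℕ} {u : Fin s → ℝ} (hu : ∀ j, 0 < u j) :
    ∫ x, expProd u x ∂cubeMeasure s = 1 := by
  simp_rw [expProd, integral_const_mul]
  rw [cubeMeasure, integral_fintype_prod_eq_prod (f := fun j t => Real.exp (-(u j * t)))]
  simp_rw [integral_unitMeasure, integral_exp_neg_mul (hu _)]
  rw [← constA_eq, inv_mul_cancel₀ (constA_pos hu).ne']

theorem pderiv_eqOn_of_eqOn_expProd {s : ℕ} {u : Fin s → ℝ} {g : (Fin s → ℝ) → ℝ} {c : ℝ}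
    (hg : EqOn g (fun x => c * expProd u x) (cube s)) (j : Fin s) :
    EqOn (pderiv j g) (fun x => (-u j) * c * expProd u x) (cube s) := by
  intro x hx
  have hP : ∀ t, expProd u (Function.update x j t)
      = (constA u)⁻¹ * (Real.exp (-(u j * t))
        * ∏ i ∈ Finset.univ.erase j, Real.exp (-(u i * x i))) := fun t => by
    rw [expProd, ← Finset.mul_prod_erase _ _ (Finset.mem_univ j), Function.update_self]
    congr 2
    exact Finset.prod_congr rfl fun i hi => by
      rw [Function.update_of_ne (Finset.ne_of_mem_erase hi)]
  have h1 : HasDerivAt (fun t => Real.exp (-(u j * t))) (Real.exp (-(u j * x j)) * -(u j * 1))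
      (x j) := ((hasDerivAt_id' (x j)).const_mul (u j)).neg.exp
  have h2 : HasDerivAt (fun t => c * expProd u (Function.update x j t))
      ((-u j) * c * expProd u x) (x j) := by
    have h3 := hP (x j)
    rw [Function.update_eq_self] at h3
    simp_rw [hP, h3]
    exact (((h1.mul_const _).const_mul _).const_mul c).congr_deriv (by ring)
  have h4 : HasDerivWithinAt (fun t => g (Function.update x j t)) ((-u j) * c * expProd u x)
      (Icc 0 1) (x j) :=
    h2.hasDerivWithinAt.congr (fun t ht => hg (update_mem_cube hx j ht))
      (hg (update_mem_cube hx j (hx j trivial)))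
  exact h4.derivWithin (uniqueDiffOn_Icc_zero_one _ (hx j trivial))

theorem iterate_pderiv_eqOn_of_eqOn_expProd {s : ℕ} {u : Fin s → ℝ} {g : (Fin s → ℝ) → ℝ} {c : ℝ}
    (hg : EqOn g (fun x => c * expProd u x) (cube s)) (j : Fin s) (i : ℕ) :
    EqOn ((pderiv j)^[i] g) (fun x => (-u j) ^ i * c * expProd u x) (cube s) := by
  induction i with
  | zero => simpa using hg
  | succ i ih =>
    rw [Function.iterate_succ_apply']
    simpa only [pow_succ', mul_assoc] using pderiv_eqOn_of_eqOn_expProd ih j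

theorem mixedPartial_expProd {s : ℕ} (u : Fin s → ℝ) (α : Fin s → ℕ) :
    EqOn (mixedPartial α (expProd u)) (fun x => (∏ j, (-u j) ^ α j) * expProd u x) (cube s) := by
  have key : ∀ l : List (Fin s), EqOn (listPartial α l (expProd u))
      (fun x => (l.map fun j => (-u j) ^ α j).prod * expProd u x) (cube s) := by
    intro l
    induction l with
    | nil => intro x _; simp [listPartial]
    | cons j l ih =>
      rw [listPartial_cons, List.map_cons, List.prod_cons]
      exact iterate_pderiv_eqOn_of_eqOn_expProd ih j (α j)
  rw [Fin.prod_univ_def]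
  exact key _

/-- Each derivative multiplies the function by `-u_j`, and the function is nonnegative with integral
1, so every quotient in the supremum equals 1. -/
theorem smoothNorm_expProd_le {s : ℕ} {u : Fin s → ℝ} (hu : ∀ j, 0 < u j) :
    smoothNorm u (expProd u) ≤ 1 := by
  refine iSup_le fun α => ?_
  refine ENNReal.div_le_of_le_mul ?_
  have hi : Integrable (expProd u) (cubeMeasure s) :=
    integrable_cubeMeasure (contDiff_expProd u).continuous.continuousOn
  rw [one_mul, restrict_cube, eLpNorm_congr_ae
    ((ae_mem_cube s).mono fun x hx => mixedPartial_expProd u α hx),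
    eLpNorm_one_eq_lintegral_enorm, ← ofReal_integral_norm_eq_lintegral_enorm (hi.const_mul _)]
  refine ENNReal.ofReal_le_ofReal (le_of_eq ?_)
  have h : ∀ x, ‖(∏ j, (-u j) ^ α j) * expProd u x‖ = (∏ j, u j ^ α j) * expProd u x := by
    intro x
    rw [Real.norm_eq_abs, abs_mul, abs_of_nonneg (expProd_nonneg hu x), Finset.abs_prod]
    congr 1
    exact Finset.prod_congr rfl fun j _ => by rw [abs_pow, abs_neg, abs_of_pos (hu j)]
  simp_rw [h]
  rw [integral_const_mul, integral_expProd hu, mul_one]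

theorem walshCoeff_expProd_ge {s : ℕ} {u : Fin s → ℝ} (hu : ∀ j, 0 < u j) {N : ℕ} (hN : 1 ≤ N)
    {k : Fin s → ℕ} (hk : ∀ j, k j < 2 ^ N) :
    constB u / constA u * (2 : ℝ) ^ (-mu u k) ≤ walshCoeff (expProd u) N k := by
  have h : walshCoeff (expProd u) N k
      = (constA u)⁻¹ * ∏ j, ∫ x in (0 : ℝ)..1, Real.exp (-(u j * x)) * wal N (k j) x := by
    simp_rw [walshCoeff, expProd, mul_assoc, integral_const_mul, ← Finset.prod_mul_distrib]
    rw [cubeMeasure, integral_fintype_prod_eq_prod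
      (f := fun j t => Real.exp (-(u j * t)) * wal N (k j) t)]
    simp_rw [integral_unitMeasure]
  rw [h, two_rpow_neg_mu hu hk, div_eq_inv_mul, mul_assoc, constB_eq, ← Finset.prod_mul_distrib]
  refine mul_le_mul_of_nonneg_left (Finset.prod_le_prod (fun j _ => ?_) fun j _ => ?_)
    (inv_nonneg.2 (constA_pos hu).le)
  · exact mul_nonneg (iInf_betaFactor_pos (hu j)).le (bitWeight_nonneg (hu j).le _ _)
  · rw [mul_comm]
    -- Any `w` with `k_j < 2^w` is admissible; `w = N` serves all coordinates, and the infimum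
    -- removes the dependence on `N`.
    exact (mul_le_mul_of_nonneg_left (iInf_betaFactor_le (hu j) hN)
      (bitWeight_nonneg (hu j).le _ _)).trans
      (bitWeight_mul_betaFactor_le_integral (hu j) (hk j) le_rfl)

theorem mul_wafom_le_err_expProd {s n m : ℕ} {u : Fin s → ℝ} (hu : ∀ j, 0 < u j)
    (C : Fin s → Matrix (Fin n) (Fin m) (ZMod 2)) :
    constB u / constA u * wafom u C ≤ err (expProd u) (digitalNet C) := by
  classical
  have hq : 0 < constB u / constA u := div_pos (constB_pos hu) (constA_pos hu)
  rw [← le_div_iff₀' hq, wafom_eq_tsum_indicator]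
  refine ((summable_two_rpow_neg_mu hu).indicator _).tsum_le_of_sum_le fun S => ?_
  rw [le_div_iff₀' hq]
  refine ge_of_tendsto (tendsto_sum_walshCoeff C (contDiff_expProd u).continuous.continuousOn) ?_
  obtain ⟨N₀, hN₀⟩ := exists_forall_subset_dyadicBox S
  -- `N ≥ N₀` puts `S` inside the box; `N ≥ 1` is needed because the infimum in `constB` excludes `w
  -- = 0`.
  filter_upwards [eventually_ge_atTop N₀, eventually_ge_atTop 1] with N h1 h2
  calc constB u / constA u * ∑ k ∈ S, (dualNet C \ {0}).indicator (fun k => (2 : ℝ) ^ (-mu u k)) k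
      ≤ constB u / constA u
          * ∑ k ∈ dyadicBox s N with k ∈ dualNet C \ {0}, (2 : ℝ) ^ (-mu u k) := by
        rw [Finset.sum_filter]
        simp_rw [indicator_apply]
        refine mul_le_mul_of_nonneg_left ?_ hq.le
        exact Finset.sum_le_sum_of_subset_of_nonneg (hN₀ N h1) fun k _ _ => by
          split_ifs <;> positivity
    _ ≤ _ := by
        rw [Finset.mul_sum]
        exact Finset.sum_le_sum fun k hk =>
          walshCoeff_expProd_ge hu h2 (mem_dyadicBox.1 (Finset.mem_filter.1 hk).1)

end QMC

end

theorem mainTheorem2 {s n m : ℕ} (hm : 1 ≤ m) (hmn : m ≤ n)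
    (u : Fin s → ℝ) (hu : ∀ j, 0 < u j)
    (C : Fin s → Matrix (Fin n) (Fin m) (ZMod 2)) :
    0 < QMC.constB u ∧
    Summable (QMC.wafomTerm u C) ∧
    BddAbove (QMC.unitBallErrors (QMC.digitalNet C) u) ∧
    QMC.constB u / QMC.constA u * QMC.wafom u C ≤
      QMC.worstCaseError (QMC.digitalNet C) u ∧
    QMC.worstCaseError (QMC.digitalNet C) u ≤ 2 ^ s * QMC.wafom u C := by
  have hub : ∀ e ∈ QMC.unitBallErrors (QMC.digitalNet C) u, e ≤ 2 ^ s * QMC.wafom u C := by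
    rintro e ⟨f, hf, h1, rfl⟩
    exact QMC.abs_err_le hu C hf.1 h1
  -- This member gives the lower bound and also shows that the set of errors is nonempty, as
  -- `csSup_le` requires.
  have hmem : |QMC.err (QMC.expProd u) (QMC.digitalNet C)|
      ∈ QMC.unitBallErrors (QMC.digitalNet C) u :=
    ⟨_, ⟨(QMC.contDiff_expProd u).contDiffOn,
      (QMC.smoothNorm_expProd_le hu).trans_lt ENNReal.one_lt_top⟩,
      QMC.smoothNorm_expProd_le hu, rfl⟩
  exact ⟨QMC.constB_pos hu, QMC.summable_wafomTerm hu C, ⟨_, hub⟩,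
    (QMC.mul_wafom_le_err_expProd hu C).trans
      ((le_abs_self _).trans (le_csSup ⟨_, hub⟩ hmem)),
    csSup_le ⟨_, hmem⟩ hub⟩
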